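/- **Proposition.** Let $\mathbf B=\{\cdots<\overline 2<\overline 1<1<2<\cdots\}$ with degree $|\overline k|=0$, $|k|=1$ for $k\ge 1$, and let $I=\{\dots,\overline 2,\overline 1,0,1,2,\dots\}$. Let $P=\mathbb Z\Lambda\oplus\bigoplus_{b\in\mathbf B}\mathbb Z\epsilon_b$, with the form $(\epsilon_b,\epsilon_{b'})=(-1)^{|b|}\delta_{bb'}$ on $\bigoplus_b\mathbb Z\epsilon_b$, simple roots $\alpha_{\overline k}=\epsilon_{\overline{k+1}}-\epsilon_{\overline k}$, $\alpha_0=\epsilon_{\overline 1}-\epsilon_1$, $\alpha_k=\epsilon_k-\epsilon_{k+1}$, and simple coroots given by $\langle h_i,\Lambda\rangle=\delta_{0i}$, $\langle h_i,\epsilon_b\rangle=(\alpha_i,\epsilon_b)$ for $i\in\{\dots,\overline 1,0\}$ and $\langle h_i,\epsilon_b\rangle=-(\alpha_i,\epsilon_b)$ for $i\in\{1,2,\dots\}$. Write $\mu\le\nu$ if $\nu-\mu\in\sum_{i}\mathbb Z_{\ge0}\alpha_i$. A *$\mathfrak g$-crystal* is a set $B$ with maps $\mathrm{wt}:B\to P$,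 $\varepsilon_i,\varphi_i:B\to\mathbb Z_{\ge0}$, $e_i,f_i:B\to B\sqcup\{0\}$ $(i\in I)$ such that: $\varphi_i(b)-\varepsilon_i(b)=\langle h_i,\mathrm{wt}(b)\rangle$ for $i\ne0$; $\langle h_0,\mathrm{wt}(b)\rangle\ge0$, and $\varphi_0(b)+\varepsilon_0(b)$ is $0$ or $1$ according as $\langle h_0,\mathrm{wt}(b)\rangle$ is zero or positive; if $e_ib\in B$ then $\varepsilon_i(e_ib)=\varepsilon_i(b)-1$, $\varphi_i(e_ib)=\varphi_i(b)+1$, $\mathrm{wt}(e_ib)=\mathrm{wt}(b)+\alpha_i$; if $f_ib\in B$ then $\varepsilon_i(f_ib)=\varepsilon_i(b)+1$, $\varphi_i(f_ib)=\varphi_i(b)-1$, $\mathrm{wt}(f_ib)=\mathrm{wt}(b)-\alpha_i$; and $f_ib=b'\iff b=e_ib'$ for $b,b'\in B$. It is a coloured graph with arrows $b\xrightarrow{i}f_ib$. The *tensor product* $B_1\otimes B_2$ is the set $B_1\times B_2$ with $\mathrm{wt}(b_1\otimes b_2)=\mathrm{wt}(b_1)+\mathrm{wt}(b_2)$ and the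 following rules ($x\otimes0=0\otimes y=0$). * For $i=\overline k$: $\varepsilon_i=\max(\varepsilon_i(b_1),\varepsilon_i(b_2)-\langle h_i,\mathrm{wt}(b_1)\rangle)$, $\varphi_i=\max(\varphi_i(b_1)+\langle h_i,\mathrm{wt}(b_2)\rangle,\varphi_i(b_2))$; $e_i$ acts on $b_1$ if $\varphi_i(b_1)\ge\varepsilon_i(b_2)$ and on $b_2$ otherwise; $f_i$ acts on $b_1$ if $\varphi_i(b_1)>\varepsilon_i(b_2)$ and on $b_2$ otherwise. * For $i=k\ge1$: $\varepsilon_i=\max(\varepsilon_i(b_1)-\langle h_i,\mathrm{wt}(b_2)\rangle,\varepsilon_i(b_2))$, $\varphi_i=\max(\varphi_i(b_1),\varphi_i(b_2)+\langle h_i,\mathrm{wt}(b_1)\rangle)$; $e_i$ acts on $b_1$ if $\varphi_i(b_2)<\varepsilon_i(b_1)$ and on $b_2$ otherwise; $f_i$ acts on $b_1$ if $\varphi_i(b_2)\le\varepsilon_i(b_1)$ and on $b_2$ otherwise. * For $i=0$: $\varepsilon_0,\varphi_0,e_0,f_0$ are those of $b_1$ if $\langle h_0,\mathrm{wt}(b_1)\rangle>0$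 and those of $b_2$ otherwise. Let $\mathscr F$ be the set of semi-infinite words $w=\cdots w_3w_2w_1$ in $\mathbf B$ with $w_{i+1}\le w_i$, with $|w_i|=1$ whenever $w_{i+1}=w_i$, and such that for some $c\in\mathbb Z$ (the *charge* of $w$) $w_i=\overline{i+c}$ for all $i\gg1$. Put $\mathrm{wt}(w)=\Lambda+\sum_b m_b\epsilon_b$, where $m_b=|\{k: w_k=b\}|-\delta_{|b|0}$. For $i\in I$ give a letter of $w$ the sign $+$ if it is the source, and $-$ if it is the target, of the arrow of colour $i$ in $$\cdots\to\overline{2}\xrightarrow{\overline 1}\overline 1\xrightarrow{0}1\xrightarrow{1}2\to\cdots,$$ and no sign otherwise, and read signs from left to right. For $i=\overline k$ (resp. $i=k\geq 1$) cancel successively pairs $(+,-)$ (resp. $(-,+)$) with no remaining sign in between, as long as possible; for $i=0$ keep only the left-most sign. Then $e_i$ changes the letter at the right-most (resp. left-most; resp. the only) remaining $-$, from the target to the source of the $i$-arrow, and $f_i$ changes the letter at the left-most (resp. right-most; resp. the only) remaining $+$ from the source to the target; the result is $0$ if there is no such sign. Put $\varepsilon_i(w)=\max\{k: e_i^kw\ne0\}$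 and $\varphi_i(w)=\max\{k: f_i^kw\neq0\}$. With these data form $\mathscr F^{\otimes u}$. Let $u\ge1$ and let $\lambda=(\lambda_1\ge\cdots\ge\lambda_u)$ be integers. Let $\mathbf B(\lambda)\subset\mathscr F^{\otimes u}$ be the set of all $\mathbf w=w^{(1)}\otimes\cdots\otimes w^{(u)}$ such that $w^{(i)}$ has charge $\lambda_i$ and, for $1\le i<u$, $k\ge1$ and $d_i=\lambda_i-\lambda_{i+1}$, one has $w^{(i)}_k\ge w^{(i+1)}_{k+d_i}$, with equality only if $|w^{(i)}_k|=0$. Let $H^\lambda=(w^{(1)},\dots,w^{(u)})$, where $w^{(i)}=\cdots\overline{\lambda_i+2}\;\overline{\lambda_i+1}$ if $\lambda_i\ge0$, and $w^{(i)}$ is $\cdots\overline 2\,\overline 1$ followed by $|\lambda_i|$ letters $u-i+1$ if $\lambda_i<0$. Then: 1. $\mathbf B(\lambda)\cup\{0\}$ is stable under $e_i$ and $f_i$ for all $i\in I$; 2. $\mathbf B(\lambda)$, with the restrictions of $\mathrm{wt},\varepsilon_i,\varphi_i,e_i,f_i$, is a $\mathfrak g$-crystal; 3. $\mathbf B(\lambda)$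 is connected as an (undirected) graph; 4. $H^\lambda$ is the unique highest weight element of $\mathbf B(\lambda)$: an element $\mathbf w\in\mathbf B(\lambda)$ satisfies $\mathrm{wt}(\mathbf w')\le\mathrm{wt}(\mathbf w)$ for all $\mathbf w'\in\mathbf B(\lambda)$ if and only if $\mathbf w=H^\lambda$. -/

import Mathlib

namespace SemiInf

/-! Encoding of letters and colours.

The ordered alphabet `⋯ < 2̄ < 1̄ < 1 < 2 < ⋯` is identified, as an ordered set, with `ℤ`:
the barred letter `k̄` is the integer `-k`, the unbarred letter `k` is the integer `k - 1` (`k ≥ 1`).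
The colours (Dynkin nodes) `⋯, 2̄, 1̄, 0, 1, 2, ⋯` are identified with `ℤ` as well: `k̄` is `-k`,
`0` is `0` and `k` is `k`. With this encoding the arrow of colour `i` in the crystal of the natural
representation goes from the letter `i - 1` to the letter `i`, for every `i : ℤ`. -/

/-- The barred letter `k̄` (`k ≥ 1`). -/
def bar (k : ℤ) : ℤ := -k

/-- The unbarred letter `k` (`k ≥ 1`). -/
def unbar (k : ℤ) : ℤ := k - 1

/-- The degree `|b|`: `0` for barred letters, `1` for unbarred letters. -/
def degree (b : ℤ) : ℕ := if b < 0 then 0 else 1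

/-! ### Weights -/

/-- The weight lattice `P = ℤ Λ ⊕ ⨁_b ℤ ε_b`: the first component is the coefficient of `Λ`. -/
abbrev Weight := ℤ × (ℤ →₀ ℤ)

/-- The symmetric form on `⨁_b ℤ ε_b` with `(ε_b, ε_b') = (-1)^|b| δ_{bb'}`. -/
def form (x y : ℤ →₀ ℤ) : ℤ := x.sum fun b a => (-1) ^ degree b * a * y b

/-- The simple root `α_i = ε_{i-1} - ε_i`. In the original notation this reads
`α_{k̄} = ε_{\overline{k+1}} - ε_{k̄}`, `α_0 = ε_{1̄} - ε_1` and `α_k = ε_k - ε_{k+1}`. -/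
noncomputable def root (i : ℤ) : ℤ →₀ ℤ :=
  Finsupp.single (i - 1) 1 - Finsupp.single i 1

/-- The pairing `⟨h_i, μ⟩` with a simple coroot: `⟨h_i, Λ⟩ = δ_{0 i}`, and on `⨁_b ℤ ε_b` it is
`(α_i, ·)` for `i = ⋯, 2̄, 1̄, 0` and `-(α_i, ·)` for `i = 1, 2, ⋯`. -/
noncomputable def coroot (i : ℤ) (μ : Weight) : ℤ :=
  (if i = 0 then μ.1 else 0) + (if i ≤ 0 then form (root i) μ.2 else -form (root i) μ.2)

/-- The simple root as an element of the weight lattice. -/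
noncomputable def simpleRoot (i : ℤ) : Weight := (0, root i)

/-- The partial order on weights: `μ ≤ ν` iff `ν - μ ∈ ∑_i ℤ_{≥0} α_i`. -/
def WeightLE (μ ν : Weight) : Prop :=
  ν - μ ∈ AddSubmonoid.closure (Set.range simpleRoot)

/-! ### Crystals -/

/-- The data of a crystal; `none` plays the role of the formal symbol `0`. -/
structure CrystalData (X : Type*) where
  wt : X → Weight
  eps : ℤ → X → ℕ
  phi : ℤ → X → ℕ
  e : ℤ → X → Option X
  f : ℤ → X → Option X

namespace CrystalData

variable {X Y : Type*}

/-- `S ∪ {0}` is stable under all the Kashiwara operators. -/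
def IsStable (C : CrystalData X) (S : Set X) : Prop :=
  ∀ i, ∀ b ∈ S, (∀ b', C.e i b = some b' → b' ∈ S) ∧ (∀ b', C.f i b = some b' → b' ∈ S)

/-- `S`, with the restrictions of `wt`, `ε_i`, `φ_i`, `e_i`, `f_i`, is a crystal. -/
structure IsCrystalOn (C : CrystalData X) (S : Set X) : Prop where
  stable : C.IsStable S
  string : ∀ i, i ≠ 0 → ∀ b ∈ S, (C.phi i b : ℤ) - C.eps i b = coroot i (C.wt b)
  odd_nonneg : ∀ b ∈ S, 0 ≤ coroot 0 (C.wt b)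
  odd_zero : ∀ b ∈ S, coroot 0 (C.wt b) = 0 → C.phi 0 b + C.eps 0 b = 0
  odd_pos : ∀ b ∈ S, 0 < coroot 0 (C.wt b) → C.phi 0 b + C.eps 0 b = 1
  e_apply : ∀ i, ∀ b ∈ S, ∀ b', C.e i b = some b' →
    (C.eps i b' : ℤ) = C.eps i b - 1 ∧ C.phi i b' = C.phi i b + 1 ∧
      C.wt b' = C.wt b + simpleRoot i
  f_apply : ∀ i, ∀ b ∈ S, ∀ b', C.f i b = some b' →
    C.eps i b' = C.eps i b + 1 ∧ (C.phi i b' : ℤ) = C.phi i b - 1 ∧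
      C.wt b' = C.wt b - simpleRoot i
  f_iff_e : ∀ i, ∀ b ∈ S, ∀ b' ∈ S, C.f i b = some b' ↔ C.e i b' = some b

/-- The coloured oriented graph on `S`, with an arrow `b → b'` of colour `i` iff `b' = f_i b`,
is connected (as an undirected graph). -/
def IsConnectedOn (C : CrystalData X) (S : Set X) : Prop :=
  S.Nonempty ∧ ∀ b b' : S, Relation.EqvGen (fun x y : S => ∃ i, C.f i x = some (y : X)) b b'

/-- `b` is a (genuine) highest weight element of `S`: its weight dominates all weights of `S`. -/
def IsHighestWeight (C : CrystalData X) (S : Set X) (b : X) : Prop :=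
  b ∈ S ∧ ∀ b' ∈ S, WeightLE (C.wt b') (C.wt b)

/-- The tensor product of crystals. In the definition of `e` and `f`, `x ⊗ 0 = 0 ⊗ y = 0`. -/
noncomputable def tensor (C : CrystalData X) (D : CrystalData Y) : CrystalData (X × Y) where
  wt b := C.wt b.1 + D.wt b.2
  eps i b :=
    if i < 0 then (max (C.eps i b.1 : ℤ) (D.eps i b.2 - coroot i (C.wt b.1))).toNat
    else if 0 < i then (max (C.eps i b.1 - coroot i (D.wt b.2)) (D.eps i b.2 : ℤ)).toNat
    else if 0 < coroot 0 (C.wt b.1) then C.eps 0 b.1 else D.eps 0 b.2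
  phi i b :=
    if i < 0 then (max (C.phi i b.1 + coroot i (D.wt b.2)) (D.phi i b.2 : ℤ)).toNat
    else if 0 < i then (max (C.phi i b.1 : ℤ) (D.phi i b.2 + coroot i (C.wt b.1))).toNat
    else if 0 < coroot 0 (C.wt b.1) then C.phi 0 b.1 else D.phi 0 b.2
  e i b :=
    let left := (C.e i b.1).map fun x => (x, b.2)
    let right := (D.e i b.2).map fun y => (b.1, y)
    if i < 0 then (if D.eps i b.2 ≤ C.phi i b.1 then left else right)
    else if 0 < i then (if D.phi i b.2 < C.eps i b.1 then left else right)
    else if 0 < coroot 0 (C.wt b.1) then left else right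
  f i b :=
    let left := (C.f i b.1).map fun x => (x, b.2)
    let right := (D.f i b.2).map fun y => (b.1, y)
    if i < 0 then (if D.eps i b.2 < C.phi i b.1 then left else right)
    else if 0 < i then (if D.phi i b.2 ≤ C.eps i b.1 then left else right)
    else if 0 < coroot 0 (C.wt b.1) then left else right

/-- The trivial crystal structure (used on a one-point set; it is the unit for `⊗`). -/
def unit (X : Type*) : CrystalData X where
  wt _ := 0
  eps _ _ := 0
  phi _ _ := 0
  e _ _ := none
  f _ _ := none

/-- Transport of crystal data along a bijection. -/
def transport (C : CrystalData X) (g : X ≃ Y) : CrystalData Y where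
  wt y := C.wt (g.symm y)
  eps i y := C.eps i (g.symm y)
  phi i y := C.phi i (g.symm y)
  e i y := (C.e i (g.symm y)).map g
  f i y := (C.f i (g.symm y)).map g

/-- The tensor power `C ⊗ (C ⊗ (⋯ ⊗ C))` on `u`-tuples; the tuple `w` is `w 0 ⊗ w 1 ⊗ ⋯`. -/
noncomputable def tensorPow (C : CrystalData X) : (u : ℕ) → CrystalData (Fin u → X)
  | 0 => unit _
  | u + 1 => (tensor C (tensorPow C u)).transport (Fin.consEquiv fun _ : Fin (u + 1) => X)

end CrystalData

/-! ### Semi-infinite words -/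

/-- The word `⋯ w_3 w_2 w_1` has charge `c`: `w_i = \overline{i + c}` for all large `i`.
Words are indexed from `0`, so that `w_i` is `w (i - 1)`. -/
def HasCharge (w : ℕ → ℤ) (c : ℤ) : Prop :=
  ∀ᶠ k : ℕ in Filter.atTop, w k = bar ((k : ℤ) + 1 + c)

/-- Semi-infinite words `⋯ w_3 w_2 w_1`, where `w_i` is `letter (i - 1)`. -/
@[ext]
structure Word where
  letter : ℕ → ℤ
  mono : ∀ k, letter (k + 1) ≤ letter k
  degree_of_eq : ∀ k, letter (k + 1) = letter k → degree (letter k) = 1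
  charge : ∃ c, HasCharge letter c

/-- The three signs `+`, `-` and `·`. -/
inductive Sgn
  | plus
  | minus
  | dot

/-- The sign of a letter with respect to the colour `i`: the source of the `i`-arrow has sign `+`,
its target has sign `-`. -/
def sgn (i : ℤ) (b : ℤ) : Sgn :=
  if b = i - 1 then Sgn.plus else if b = i then Sgn.minus else Sgn.dot

/-- One cancellation: a pair `(a, b)`, `a` on the left of `b`, with only `·` in between, is replaced
by `(·, ·)`. Positions of a sequence `⋯ σ 2, σ 1, σ 0` with larger index are further to the left. -/
def CancelStep (a b : Sgn) (σ τ : ℕ → Sgn) : Prop :=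
  ∃ s s', s' < s ∧ σ s = a ∧ σ s' = b ∧ (∀ t, s' < t → t < s → σ t = Sgn.dot) ∧
    τ = Function.update (Function.update σ s Sgn.dot) s' Sgn.dot

/-- `τ` arises from `σ` by cancelling `(a, b)`-pairs until no `a` is on the left of a `b`. -/
def FullyCancelled (a b : Sgn) (σ τ : ℕ → Sgn) : Prop :=
  Relation.ReflTransGen (CancelStep a b) σ τ ∧ ∀ s s', s' < s → ¬(τ s = a ∧ τ s' = b)

open Classical in
/-- `τ` is the `i`-signature of a word with sign sequence `σ`: cancel `(+, -)` if `i < 0` (that is,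
`i` is barred), cancel `(-, +)` if `i > 0`, and keep only the left-most sign if `i = 0`. -/
def IsSignature (i : ℤ) (σ τ : ℕ → Sgn) : Prop :=
  (i < 0 → FullyCancelled Sgn.plus Sgn.minus σ τ) ∧
  (0 < i → FullyCancelled Sgn.minus Sgn.plus σ τ) ∧
  (i = 0 → ∀ k, τ k = if ∀ l, k < l → σ l = Sgn.dot then σ k else Sgn.dot)

/-- Position `k` carries the `i`-good `-` sign: the right-most (`i < 0`) resp. left-most (`i > 0`)
`-` of the `i`-signature, or the `0`-signature is a `-` at `k`. -/
def IsGoodMinus (i : ℤ) (w : ℕ → ℤ) (k : ℕ) : Prop :=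
  ∃ τ, IsSignature i (fun j => sgn i (w j)) τ ∧ τ k = Sgn.minus ∧
    (i < 0 → ∀ l, l < k → τ l ≠ Sgn.minus) ∧ (0 < i → ∀ l, k < l → τ l ≠ Sgn.minus)

/-- Position `k` carries the `i`-good `+` sign: the left-most (`i < 0`) resp. right-most (`i > 0`)
`+` of the `i`-signature, or the `0`-signature is a `+` at `k`. -/
def IsGoodPlus (i : ℤ) (w : ℕ → ℤ) (k : ℕ) : Prop :=
  ∃ τ, IsSignature i (fun j => sgn i (w j)) τ ∧ τ k = Sgn.plus ∧
    (i < 0 → ∀ l, k < l → τ l ≠ Sgn.plus) ∧ (0 < i → ∀ l, l < k → τ l ≠ Sgn.plus)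

theorem sgn_eq_plus {i b : ℤ} : sgn i b = Sgn.plus ↔ b = i - 1 := by
  unfold sgn; split_ifs <;> simp_all

theorem sgn_eq_minus {i b : ℤ} : sgn i b = Sgn.minus ↔ b = i := by
  unfold sgn; split_ifs <;> simp_all

theorem sgn_eq_dot {i b : ℤ} : sgn i b = Sgn.dot ↔ b ≠ i - 1 ∧ b ≠ i := by
  unfold sgn; split_ifs <;> simp_all

theorem CancelStep.apply_eq {a b : Sgn} {σ τ : ℕ → Sgn} (h : CancelStep a b σ τ) (k : ℕ) :
    τ k = σ k ∨ τ k = Sgn.dot := by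
  obtain ⟨s, s', -, -, -, -, rfl⟩ := h
  by_cases h1 : k = s' <;> by_cases h2 : k = s <;> simp [Function.update_apply, h1, h2]

theorem FullyCancelled.apply_eq {a b : Sgn} {σ τ : ℕ → Sgn} (h : FullyCancelled a b σ τ) (k : ℕ) :
    τ k = σ k ∨ τ k = Sgn.dot := by
  obtain ⟨h, -⟩ := h
  induction h with
  | refl => exact Or.inl rfl
  | tail _ hs ih =>
    rcases hs.apply_eq k with h' | h'
    · rw [h']; exact ih
    · exact Or.inr h'

theorem IsSignature.apply_eq {i : ℤ} {σ τ : ℕ → Sgn} (h : IsSignature i σ τ) (k : ℕ) :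
    τ k = σ k ∨ τ k = Sgn.dot := by
  rcases lt_trichotomy i 0 with hi | hi | hi
  · exact (h.1 hi).apply_eq k
  · rw [h.2.2 hi k]; split_ifs <;> simp
  · exact (h.2.1 hi).apply_eq k

/-- Adjacent `(a, b)` are cancelled. -/
theorem FullyCancelled.adjacent {a b : Sgn} {σ τ : ℕ → Sgn} (h : FullyCancelled a b σ τ)
    (hab : a ≠ b) (ha : a ≠ Sgn.dot) (hb : b ≠ Sgn.dot) {k : ℕ} (h1 : σ (k + 1) = a)
    (h2 : σ k = b) : τ (k + 1) = Sgn.dot ∧ τ k = Sgn.dot := by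
  obtain ⟨h, hr⟩ := h
  have key : (τ (k + 1) = a ∧ τ k = b) ∨ (τ (k + 1) = Sgn.dot ∧ τ k = Sgn.dot) := by
    clear hr
    induction h with
    | refl => exact Or.inl ⟨h1, h2⟩
    | @tail ρ τ _ hs ih =>
      rcases ih with ⟨e1, e2⟩ | ⟨e1, e2⟩
      · obtain ⟨s, s', hlt, q1, q2, q3, rfl⟩ := hs
        have n1 : s' ≠ k + 1 := by rintro rfl; exact hab (e1.symm.trans q2)
        have n2 : s ≠ k := by rintro rfl; exact hab (q1.symm.trans e2)
        by_cases c1 : s = k + 1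
        · have c2 : s' = k := by
            by_contra hne
            exact hb (e2.symm.trans (q3 k (by omega) (by omega)))
          subst c1; subst c2
          right; simp
        · have c2 : s' ≠ k := by
            intro hk
            exact ha (e1.symm.trans (q3 (k + 1) (by omega) (by omega)))
          left
          simp [Ne.symm n1, Ne.symm n2, Ne.symm c1, Ne.symm c2, e1, e2]
      · right
        constructor
        · rcases hs.apply_eq (k + 1) with h' | h'
          · rw [h', e1]
          · exact h'
        · rcases hs.apply_eq k with h' | h'
          · rw [h', e2]
          · exact h'
  rcases key with ⟨e1, e2⟩ | h
  · exact absurd ⟨e1, e2⟩ (hr (k + 1) k (Nat.lt_succ_self k))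
  · exact h

theorem FullyCancelled.eq_self {a b : Sgn} {σ τ : ℕ → Sgn} (h : FullyCancelled a b σ τ)
    (hno : ∀ s s', s' < s → ¬(σ s = a ∧ σ s' = b)) : τ = σ := by
  rcases Relation.ReflTransGen.cases_head h.1 with h' | ⟨ρ, ⟨s, s', hlt, q1, q2, -⟩, -⟩
  · exact h'.symm
  · exact absurd ⟨q1, q2⟩ (hno s s' hlt)

theorem degree_eq_one {b : ℤ} : degree b = 1 ↔ 0 ≤ b := by
  unfold degree; split_ifs with h <;> simp <;> omega

namespace Word

theorem antitone (w : Word) : Antitone w.letter := antitone_nat_of_succ_le w.mono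

/-- Replace the letter at position `k`. -/
def replace (w : Word) (k : ℕ) (b : ℤ) (h1 : w.letter (k + 1) ≤ b)
    (h1' : w.letter (k + 1) = b → 0 ≤ b) (h2 : ∀ j, j + 1 = k → b ≤ w.letter j)
    (h2' : ∀ j, j + 1 = k → b = w.letter j → 0 ≤ b) : Word where
  letter := Function.update w.letter k b
  mono j := by
    have := w.mono j
    by_cases c1 : j = k
    · subst c1; simpa [Function.update_apply] using h1
    · by_cases c2 : j + 1 = k
      · simpa [Function.update_apply, c1, c2] using h2 j c2
      · simpa [Function.update_apply, c1, c2] using this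
  degree_of_eq j := by
    have := w.degree_of_eq j
    rw [degree_eq_one] at this ⊢
    by_cases c1 : j = k
    · subst c1; simpa [Function.update_apply] using h1'
    · by_cases c2 : j + 1 = k
      · have h := h2' j c2
        simp only [Function.update_apply, c1, c2, if_true, if_false]
        intro h3; rw [← h3]; exact h h3
      · simpa [Function.update_apply, c1, c2] using this
  charge := by
    obtain ⟨c, hc⟩ := w.charge
    refine ⟨c, ?_⟩
    filter_upwards [hc, Filter.eventually_gt_atTop k] with j hj hjk
    rw [Function.update_of_ne hjk.ne']; exact hj

theorem goodMinus_letter {w : Word} {i : ℤ} {k : ℕ} (h : IsGoodMinus i w.letter k) :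
    w.letter k = i := by
  obtain ⟨τ, hs, hk, -⟩ := h
  rcases hs.apply_eq k with h' | h'
  · rw [hk] at h'; exact sgn_eq_minus.1 h'.symm
  · rw [hk] at h'; simp at h'

theorem goodPlus_letter {w : Word} {i : ℤ} {k : ℕ} (h : IsGoodPlus i w.letter k) :
    w.letter k = i - 1 := by
  obtain ⟨τ, hs, hk, -⟩ := h
  rcases hs.apply_eq k with h' | h'
  · rw [hk] at h'; exact sgn_eq_plus.1 h'.symm
  · rw [hk] at h'; simp at h'

theorem no_minus_plus (w : Word) (i : ℤ) (s s' : ℕ) (h : s' < s) :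
    ¬(sgn i (w.letter s) = Sgn.minus ∧ sgn i (w.letter s') = Sgn.plus) := by
  rw [sgn_eq_minus, sgn_eq_plus]
  have := w.antitone h.le
  omega

theorem goodMinus_next {w : Word} {i : ℤ} {k : ℕ} (h : IsGoodMinus i w.letter k) :
    w.letter (k + 1) ≤ i - 1 ∧ (w.letter (k + 1) = i - 1 → 0 ≤ i - 1) := by
  have hk := goodMinus_letter h
  obtain ⟨τ, hs, hm, hneg, hpos⟩ := h
  have hmono := w.mono k
  have hdeg := w.degree_of_eq k
  rw [degree_eq_one] at hdeg
  rcases lt_trichotomy i 0 with hi | hi | hi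
  · have hne : w.letter (k + 1) ≠ i - 1 := by
      intro h1
      have := ((hs.1 hi).adjacent (by simp) (by simp) (by simp)
        (sgn_eq_plus.2 h1) (sgn_eq_minus.2 hk)).2
      rw [hm] at this; simp at this
    omega
  · subst hi
    have hd : w.letter (k + 1) ≠ -1 ∧ w.letter (k + 1) ≠ 0 := by
      have h0 := hs.2.2 rfl k
      rw [hm] at h0
      split_ifs at h0 with hall
      simpa using sgn_eq_dot.1 (hall (k + 1) (Nat.lt_succ_self k))
    omega
  · have hτ := (hs.2.1 hi).eq_self (w.no_minus_plus i)
    subst hτ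
    have := hpos hi (k + 1) (Nat.lt_succ_self k)
    rw [Ne, sgn_eq_minus] at this
    omega

theorem goodPlus_prev {w : Word} {i : ℤ} {j : ℕ} (h : IsGoodPlus i w.letter (j + 1)) :
    i ≤ w.letter j ∧ (i = w.letter j → 0 ≤ i) := by
  have hk := goodPlus_letter h
  obtain ⟨τ, hs, hm, hneg, hpos⟩ := h
  have hmono := w.mono j
  have hdeg := w.degree_of_eq j
  rw [degree_eq_one] at hdeg
  rcases lt_trichotomy i 0 with hi | hi | hi
  · have hne : w.letter j ≠ i := by
      intro h1
      have := ((hs.1 hi).adjacent (by simp) (by simp) (by simp)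
        (sgn_eq_plus.2 hk) (sgn_eq_minus.2 h1)).1
      rw [hm] at this; simp at this
    omega
  · omega
  · have hτ := (hs.2.1 hi).eq_self (w.no_minus_plus i)
    subst hτ
    have := hpos hi j (Nat.lt_succ_self j)
    rw [Ne, sgn_eq_plus] at this
    omega

/-- Apply `e_i` to the letter at the position of the `i`-good `-` sign. -/
def applyE (w : Word) (i : ℤ) (k : ℕ) (h : IsGoodMinus i w.letter k) : Word :=
  w.replace k (i - 1) (goodMinus_next h).1 (goodMinus_next h).2
    (fun j hj => by
      subst hj; have := goodMinus_letter h; have := w.mono j; omega)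
    (fun j hj h' => by
      subst hj; have := goodMinus_letter h; have := w.mono j; omega)

/-- Apply `f_i` to the letter at the position of the `i`-good `+` sign. -/
def applyF (w : Word) (i : ℤ) (k : ℕ) (h : IsGoodPlus i w.letter k) : Word :=
  w.replace k i
    (by have := goodPlus_letter h; have := w.mono k; omega)
    (by have := goodPlus_letter h; have := w.mono k; omega)
    (fun j hj => by subst hj; exact (goodPlus_prev h).1)
    (fun j hj => by subst hj; exact (goodPlus_prev h).2)

open Classical in
/-- The Kashiwara operator `e_i` on semi-infinite words. -/
noncomputable def eOp (i : ℤ) (w : Word) : Option Word :=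
  if h : ∃ k, IsGoodMinus i w.letter k then some (w.applyE i h.choose h.choose_spec) else none

open Classical in
/-- The Kashiwara operator `f_i` on semi-infinite words. -/
noncomputable def fOp (i : ℤ) (w : Word) : Option Word :=
  if h : ∃ k, IsGoodPlus i w.letter k then some (w.applyF i h.choose h.choose_spec) else none

/-- `m_b`, the number of occurrences of `b` in `w`, minus `1` if `|b| = 0`. -/
noncomputable def mult (w : Word) (b : ℤ) : ℤ :=
  ({k : ℕ | w.letter k = b}.ncard : ℤ) - if degree b = 0 then 1 else 0

theorem mult_support_finite (w : Word) : (Function.support w.mult).Finite := by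
  obtain ⟨c, hc⟩ := w.charge
  obtain ⟨K, hK⟩ := Filter.eventually_atTop.1 hc
  refine (Set.finite_Icc (min 0 (-((K : ℤ) + 1 + c))) (max 0 (w.letter 0))).subset ?_
  intro b hb
  by_contra hout
  apply hb
  rw [Set.mem_Icc, not_and_or, not_le, not_le] at hout
  rcases hout with h | h
  · rw [lt_min_iff] at h
    have hset : {k : ℕ | w.letter k = b} = {(-b - 1 - c).toNat} := by
      ext k
      simp only [Set.mem_ofPred_eq, Set.mem_singleton_iff]
      constructor
      · intro hk
        have hKk : K ≤ k := by
          by_contra hlt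
          have h1 := w.antitone (not_le.1 hlt).le
          have h2 := hK K le_rfl
          simp only [bar] at h2
          omega
        have h2 := hK k hKk
        simp only [bar] at h2
        omega
      · rintro rfl
        have h2 := hK (-b - 1 - c).toNat (by omega)
        simp only [bar] at h2
        rw [h2]
        omega
    simp [mult, hset, degree, h.1]
  · rw [max_lt_iff] at h
    have hset : {k : ℕ | w.letter k = b} = ∅ := by
      ext k
      simp only [Set.mem_ofPred_eq, Set.mem_empty_iff_false, iff_false]
      intro hk
      have h1 := w.antitone (Nat.zero_le k)
      omega
    have hb' : ¬ b < 0 := by omega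
    simp [mult, hset, degree, hb']

/-- The weight `Λ + ∑_b m_b ε_b` of a semi-infinite word. -/
noncomputable def wt (w : Word) : Weight := (1, Finsupp.ofSupportFinite w.mult w.mult_support_finite)

/-- `max {k | g^k x ≠ 0}` for a partially defined operator `g`. -/
noncomputable def maxIter {X : Type*} (g : X → Option X) (x : X) : ℕ :=
  sSup {k : ℕ | (fun y : Option X => y.bind g)^[k] (some x) ≠ none}

/-- The crystal `𝓕` of semi-infinite words. -/
noncomputable def crystal : CrystalData Word where
  wt := wt
  eps i := maxIter (eOp i)
  phi i := maxIter (fOp i)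
  e := eOp
  f := fOp

end Word

/-! ### Semi-infinite semistandard tableaux -/

/-- `𝐁(λ)`: the semistandard tableaux of charge `λ`. The column `w^{(i)}` is `w (i - 1)`. -/
def tableaux {u : ℕ} (lam : Fin u → ℤ) : Set (Fin u → Word) :=
  {w | (∀ i, HasCharge (w i).letter (lam i)) ∧
    ∀ i j : Fin u, (j : ℕ) = i + 1 → ∀ k : ℕ,
      (w j).letter (k + (lam i - lam j).toNat) ≤ (w i).letter k ∧
      ((w i).letter k = (w j).letter (k + (lam i - lam j).toNat) → degree ((w i).letter k) = 0)}

/-- The word `⋯ \overline{c+2} \overline{c+1}` if `c ≥ 0`, and the word `⋯ 2̄ 1̄ j ⋯ j`, with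
`|c|` letters `j`, if `c < 0`; here `j ≥ 1`. -/
def hwWord (c : ℤ) (j : ℕ) (hj : 1 ≤ j) : Word where
  letter k := if (k : ℤ) + c < 0 then unbar j else bar ((k : ℤ) + 1 + c)
  mono k := by
    simp only [unbar, bar]; push_cast; split_ifs <;> omega
  degree_of_eq k := by
    simp only [unbar, bar, degree]; push_cast; split_ifs <;> omega
  charge := by
    refine ⟨c, ?_⟩
    filter_upwards [Filter.eventually_ge_atTop (-c).toNat] with k hk
    rw [if_neg (by omega)]

/-- `H^λ`: its `i`-th column (`i = 1, ⋯, u`) is `⋯ \overline{λ_i+2} \overline{λ_i+1}` if `λ_i ≥ 0`,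
and `⋯ 2̄ 1̄` followed by `|λ_i|` letters `u - i + 1` if `λ_i < 0`. -/
def highest {u : ℕ} (lam : Fin u → ℤ) : Fin u → Word :=
  fun i => hwWord (lam i) (u - i) (by omega)

end SemiInf

namespace SemiInf

/-! Letters and colours are integers, and colour `i` joins the letters `i - 1` and `i`. A word
increases weakly from left to right, so `e_i w = w'` holds exactly when `w'` is a word obtained from
`w` by changing a single letter `i` into `i - 1` (`eOp_eq_some_iff`, `fOp_eq_some_iff`). Signatures
then disappear, and `ε_i`, `φ_i` become functions of the multiplicities of `i - 1` and `i`.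

Crystal structure: call a crystal normal if `ε_i > 0` forces `e_i ≠ 0` and `φ_i > 0` forces `f_i ≠
0`. Words form a normal crystal and normality passes to tensor products, so every tensor power is a
crystal. On tableaux only stability is left to prove.

Stability: an operator on a tensor power changes one column. At that column the tensor rule prefers
the left factor when compared with the next column, and the right factor when compared with the
previous one (`exists_actsAt_of_e`, `exists_actsAt_of_f`). This leaves two adjacent columns, where
only lowering the left column and raising the right one could do harm; the rule excludes this
(`Adjacent.e_left`, `Adjacent.f_right`).

Highest weight: `H^λ` is letterwise the least tableau. A letterwise inequality turns the difference
of weights into a sum of terms `ε_a - ε_b` with `a ≤ b`, hence of simple roots, and the height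
functional shows that equal weights force equal tableaux.

Connectedness: position `k` of column `j` lies in row `k + λ_j`. Fix `K` such that all rows from `K`
on are trivial in both given tableaux, and use only colours above `-K`. The letter `0` (that is,
`1`) can be emptied by pushing unbarred letters up. If a barred letter is left among `\overline K,
…, \overline 1`, some `\overline 1` can be produced, and then `f_0` must act and lowers the number
of barred letters. Once there are none, operators `e_i` with `i > 0` lead to one fixed tableau
`least K`, to which both given tableaux are therefore linked. -/

/-! ### Simple roots and coroots in coordinates -/

theorem form_root (i : ℤ) (y : ℤ →₀ ℤ) :
    form (root i) y = (-1) ^ degree (i - 1) * y (i - 1) - (-1) ^ degree i * y i := by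
  unfold form root
  rw [Finsupp.sum_sub_index (by intros; ring), Finsupp.sum_single_index (by ring),
    Finsupp.sum_single_index (by ring)]
  ring

theorem coroot_of_neg {i : ℤ} (hi : i < 0) (μ : Weight) : coroot i μ = μ.2 (i - 1) - μ.2 i := by
  simp [coroot, form_root, hi.ne, hi.le, degree, hi, show i - 1 < 0 by omega]

theorem coroot_of_pos {i : ℤ} (hi : 0 < i) (μ : Weight) : coroot i μ = μ.2 (i - 1) - μ.2 i := by
  simp [coroot, form_root, hi.ne', hi.not_ge, degree, hi.not_gt, show ¬ i - 1 < 0 by omega]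
  ring

/-- For `i ≠ 0` the letters `i - 1` and `i` have the same degree; when both are odd, the sign of the
form cancels the sign in the coroot. For `i = 0` the degrees differ, whence the sum in
`coroot_zero`. -/
theorem coroot_of_ne {i : ℤ} (hi : i ≠ 0) (μ : Weight) : coroot i μ = μ.2 (i - 1) - μ.2 i :=
  hi.lt_or_gt.elim (coroot_of_neg · μ) (coroot_of_pos · μ)

theorem coroot_zero (μ : Weight) : coroot 0 μ = μ.1 + μ.2 (-1) + μ.2 0 := by
  simp [coroot, form_root, degree]
  ring

theorem coroot_add (i : ℤ) (μ ν : Weight) : coroot i (μ + ν) = coroot i μ + coroot i ν := by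
  rcases eq_or_ne i 0 with rfl | hi
  · simp only [coroot_zero, Prod.fst_add, Prod.snd_add, Finsupp.add_apply]; ring
  · simp only [coroot_of_ne hi, Prod.snd_add, Finsupp.add_apply]; ring

theorem coroot_weight_zero (i : ℤ) : coroot i 0 = 0 := by
  have := coroot_add i 0 0
  rw [add_zero] at this
  omega

theorem root_apply (i b : ℤ) :
    root i b = (if b = i - 1 then 1 else 0) - (if b = i then 1 else 0) := by
  simp [root, Finsupp.single_apply, eq_comm]

theorem coroot_simpleRoot_zero : coroot 0 (simpleRoot 0) = 0 := by
  simp [coroot_zero, simpleRoot, root_apply]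

/-! ### Kashiwara operators on words as changes of a single letter -/

namespace Word

theorem letter_lt (w : Word) {s t : ℕ} (h : s < t) (hs : w.letter s < 0) :
    w.letter t < w.letter s := by
  have h1 := w.antitone (Nat.succ_le_of_lt h)
  have h2 := w.mono s
  have h3 := w.degree_of_eq s
  rw [degree_eq_one] at h3
  simp only [Nat.succ_eq_add_one] at h1
  omega

theorem finite_letter_eq (w : Word) (b : ℤ) : {k | w.letter k = b}.Finite := by
  obtain ⟨c, hc⟩ := w.charge
  obtain ⟨K, hK⟩ := Filter.eventually_atTop.1 hc
  refine (Set.finite_Iio (K + (-b - c).toNat)).subset ?_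
  intro k hk
  by_contra hlt
  rw [Set.mem_Iio, not_lt] at hlt
  have h1 := hK k (by omega)
  simp only [bar, Set.mem_ofPred_eq] at h1 hk
  omega

/-- The number of occurrences of the letter `b`. -/
noncomputable def count (w : Word) (b : ℤ) : ℕ := {k | w.letter k = b}.ncard

theorem count_pos {w : Word} {b : ℤ} : 0 < w.count b ↔ ∃ k, w.letter k = b := by
  rw [count, Set.ncard_pos (w.finite_letter_eq b)]; rfl

theorem count_eq_zero {w : Word} {b : ℤ} : w.count b = 0 ↔ ∀ k, w.letter k ≠ b := by
  have := count_pos (w := w) (b := b)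
  rw [← not_iff_not, ← ne_eq, ← Nat.pos_iff_ne_zero, this]
  push Not; rfl

theorem count_le_one (w : Word) {b : ℤ} (hb : b < 0) : w.count b ≤ 1 := by
  rw [count, Set.ncard_le_one (w.finite_letter_eq b)]
  intro s hs t ht
  simp only [Set.mem_ofPred_eq] at hs ht
  rcases lt_trichotomy s t with h | h | h
  · have := w.letter_lt h (by omega); omega
  · exact h
  · have := w.letter_lt h (by omega); omega

/-- `w'` arises from `w` by changing one letter `i` into `i - 1`. -/
def Lowers (i : ℤ) (w w' : Word) : Prop :=
  ∃ k, w.letter k = i ∧ w'.letter = Function.update w.letter k (i - 1)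

/-- If two positions carry `i`, lowering the one further right leaves an `i` to the left of an `i -
1`, which is not a word. -/
theorem Lowers.unique_right {i : ℤ} {w w₁ w₂ : Word} (h₁ : Lowers i w w₁) (h₂ : Lowers i w w₂) :
    w₁ = w₂ := by
  obtain ⟨k, hk, h₁⟩ := h₁
  obtain ⟨l, hl, h₂⟩ := h₂
  have hkl : k = l := by
    rcases lt_trichotomy k l with h | h | h
    · have := w₁.antitone h.le
      rw [h₁, Function.update_self, Function.update_of_ne h.ne'] at this
      omega
    · exact h
    · have := w₂.antitone h.le
      rw [h₂, Function.update_self, Function.update_of_ne h.ne'] at this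
      omega
  subst hkl
  exact Word.ext (h₁.trans h₂.symm)

theorem Lowers.eq_update {i : ℤ} {w w' : Word} {k : ℕ} (hk : w.letter k = i)
    (h : w'.letter = Function.update w.letter k (i - 1)) :
    w'.letter k = i - 1 ∧ w.letter = Function.update w'.letter k i := by
  rw [h]
  simp [← hk]

theorem Lowers.unique_left {i : ℤ} {w w₁ w₂ : Word} (h₁ : Lowers i w₁ w) (h₂ : Lowers i w₂ w) :
    w₁ = w₂ := by
  obtain ⟨k, hk, h₁⟩ := h₁
  obtain ⟨l, hl, h₂⟩ := h₂
  obtain ⟨hk', h₁⟩ := Lowers.eq_update hk h₁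
  obtain ⟨hl', h₂⟩ := Lowers.eq_update hl h₂
  have hkl : k = l := by
    rcases lt_trichotomy k l with h | h | h
    · have := w₂.antitone h.le
      rw [h₂, Function.update_self, Function.update_of_ne h.ne] at this
      omega
    · exact h
    · have := w₁.antitone h.le
      rw [h₁, Function.update_self, Function.update_of_ne h.ne] at this
      omega
  subst hkl
  exact Word.ext (h₁.trans h₂.symm)

theorem fullyCancelled_self {a b : Sgn} {σ : ℕ → Sgn}
    (h : ∀ s s', s' < s → ¬(σ s = a ∧ σ s' = b)) : FullyCancelled a b σ σ :=
  ⟨Relation.ReflTransGen.refl, h⟩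

theorem isSignature_self {w : Word} {i : ℤ} (hi : i ≠ 0)
    (h : i < 0 → ∀ s s', s' < s → ¬(w.letter s = i - 1 ∧ w.letter s' = i)) :
    IsSignature i (fun j => sgn i (w.letter j)) (fun j => sgn i (w.letter j)) := by
  refine ⟨fun hn => fullyCancelled_self ?_, fun _ => fullyCancelled_self (w.no_minus_plus i),
    fun h0 => absurd h0 hi⟩
  intro s s' hs
  rw [sgn_eq_plus, sgn_eq_minus]
  exact h hn s s' hs

open Classical in
theorem isSignature_zero (σ : ℕ → Sgn) : IsSignature 0 σ
    (fun k => if ∀ l, k < l → σ l = Sgn.dot then σ k else Sgn.dot) :=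
  ⟨fun h => absurd h (lt_irrefl _), fun h => absurd h (lt_irrefl _), fun _ _ => rfl⟩

/-- That the changed sequence is still a word forces position `k` to be good. For `i ≤ 0` the letter
`i - 1` is barred and cannot repeat in `w'`, so `w` has no `i - 1` and nothing cancels; for `i > 0`
nothing ever cancels, and `k` must be the left-most `i`. -/
theorem isGoodMinus_of_lowers {i : ℤ} {w w' : Word} {k : ℕ} (hk : w.letter k = i)
    (h : w'.letter = Function.update w.letter k (i - 1)) : IsGoodMinus i w.letter k := by
  have hk' := (Lowers.eq_update hk h).1
  have hne : ∀ t, t ≠ k → w'.letter t = w.letter t := fun t ht => by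
    rw [h, Function.update_of_ne ht]
  have hnext : ∀ t, k < t → w.letter t ≤ i - 1 ∧ (i ≤ 0 → w.letter t < i - 1) := by
    intro t ht
    rw [← hne t ht.ne', ← hk']
    exact ⟨w'.antitone ht.le, fun hi => w'.letter_lt ht (by omega)⟩
  rcases eq_or_ne i 0 with rfl | hi
  · refine ⟨_, isSignature_zero _, ?_, fun h => absurd h (lt_irrefl _),
      fun h => absurd h (lt_irrefl _)⟩
    rw [if_pos, sgn_eq_minus]
    · exact hk
    · intro l hl
      rw [sgn_eq_dot]
      have := (hnext l hl).2 le_rfl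
      omega
  · refine ⟨_, isSignature_self hi ?_, sgn_eq_minus.2 hk, fun hn l hl => ?_, fun _ l hl => ?_⟩
    · rintro hn s s' hs ⟨h1, h2⟩
      have hs' : s' = k := by
        rcases lt_trichotomy s' k with h | h | h
        · have := w.letter_lt h (by omega); omega
        · exact h
        · have := w.letter_lt h (by omega); omega
      have := (hnext s (by omega)).2 hn.le
      omega
    · rw [Ne, sgn_eq_minus]
      intro h1
      have := w.letter_lt hl (by omega)
      omega
    · rw [Ne, sgn_eq_minus]
      have := (hnext l hl).1
      omega

theorem isGoodPlus_of_lowers {i : ℤ} {w w' : Word} {k : ℕ} (hk : w.letter k = i - 1)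
    (h : w'.letter = Function.update w.letter k i) : IsGoodPlus i w.letter k := by
  have hk' : w'.letter k = i := by rw [h, Function.update_self]
  have hne : ∀ t, t ≠ k → w'.letter t = w.letter t := fun t ht => by
    rw [h, Function.update_of_ne ht]
  have hprev : ∀ t, t < k → i ≤ w.letter t ∧ (i < 0 → i < w.letter t) := by
    intro t ht
    rw [← hne t ht.ne]
    have h1 := w'.antitone ht.le
    refine ⟨by omega, fun hi => ?_⟩
    by_contra hlt
    have := w'.letter_lt ht (by omega)
    omega
  rcases eq_or_ne i 0 with rfl | hi
  · refine ⟨_, isSignature_zero _, ?_, fun h => absurd h (lt_irrefl _),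
      fun h => absurd h (lt_irrefl _)⟩
    rw [if_pos, sgn_eq_plus]
    · exact hk
    · intro l hl
      rw [sgn_eq_dot]
      have := w.letter_lt hl (by omega)
      omega
  · refine ⟨_, isSignature_self hi ?_, sgn_eq_plus.2 hk, fun hn l hl => ?_, fun _ l hl => ?_⟩
    · rintro hn s s' hs ⟨h1, h2⟩
      have hs' : s = k := by
        rcases lt_trichotomy s k with h | h | h
        · have := w.letter_lt h (by omega); omega
        · exact h
        · have := w.letter_lt h (by omega); omega
      have := (hprev s' (by omega)).2 hn
      omega
    · rw [Ne, sgn_eq_plus]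
      intro h1
      have := w.letter_lt hl (by omega)
      omega
    · rw [Ne, sgn_eq_plus]
      have := (hprev l hl).1
      omega

/-- The choice of a good position in `eOp` is harmless, since the lowered word is unique. From here
on signatures are no longer needed. -/
theorem eOp_eq_some_iff {i : ℤ} {w w' : Word} : eOp i w = some w' ↔ Lowers i w w' := by
  have key : ∀ w'', eOp i w = some w'' → Lowers i w w'' := by
    intro w'' h
    unfold eOp at h
    split_ifs at h with hg
    rw [Option.some_inj] at h
    subst h
    exact ⟨_, goodMinus_letter hg.choose_spec, rfl⟩
  refine ⟨key w', fun h => ?_⟩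
  obtain ⟨k, hk, hw'⟩ := h
  have hex : ∃ k, IsGoodMinus i w.letter k := ⟨k, isGoodMinus_of_lowers hk hw'⟩
  have h1 : eOp i w = some (w.applyE i hex.choose hex.choose_spec) := dif_pos hex
  rw [h1, Option.some_inj]
  exact (key _ h1).unique_right ⟨k, hk, hw'⟩

theorem fOp_eq_some_iff {i : ℤ} {w w' : Word} : fOp i w = some w' ↔ Lowers i w' w := by
  have key : ∀ w'', fOp i w = some w'' → Lowers i w'' w := by
    intro w'' h
    unfold fOp at h
    split_ifs at h with hg
    rw [Option.some_inj] at h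
    subst h
    have := goodPlus_letter hg.choose_spec
    refine ⟨hg.choose, ?_, ?_⟩
    · simp [applyF, replace]
    · simp [applyF, replace, ← this]
  refine ⟨key w', fun h => ?_⟩
  obtain ⟨k, hk, hw'⟩ := id h
  have h2 := Lowers.eq_update hk hw'
  have hex : ∃ k, IsGoodPlus i w.letter k := ⟨k, isGoodPlus_of_lowers h2.1 h2.2⟩
  have h1 : fOp i w = some (w.applyF i hex.choose hex.choose_spec) := dif_pos hex
  rw [h1, Option.some_inj]
  exact (key _ h1).unique_left h

/-! ### `ε_i`, `φ_i` and weights of words through multiplicities -/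

theorem Lowers.count_eq {i : ℤ} {w w' : Word} (h : Lowers i w w') (b : ℤ) :
    w'.count b + (if b = i then 1 else 0) = w.count b + (if b = i - 1 then 1 else 0) := by
  obtain ⟨k, hk, h⟩ := h
  unfold count
  by_cases h1 : b = i
  · have hs : {l | w.letter l = b} = insert k {l | w'.letter l = b} := by
      ext l
      by_cases hl : l = k
      · simp [hl, hk, h1]
      · simp [h, hl]
    rw [hs, Set.ncard_insert_of_notMem _ (w'.finite_letter_eq b)]
    · simp [h1, show i ≠ i - 1 by omega]
    · simp [h, h1]
  · by_cases h2 : b = i - 1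
    · have hs : {l | w'.letter l = b} = insert k {l | w.letter l = b} := by
        ext l
        by_cases hl : l = k
        · simp [hl, h2, h]
        · simp [h, hl]
      rw [hs, Set.ncard_insert_of_notMem _ (w.finite_letter_eq b)]
      · simp [h2]
      · simp only [Set.mem_ofPred_eq]; omega
    · have hs : {l | w'.letter l = b} = {l | w.letter l = b} := by
        ext l
        by_cases hl : l = k
        · simp only [Set.mem_ofPred_eq, h, hl, Function.update_self, hk]
          omega
        · simp [h, hl]
      simp [hs, h1, h2]

/-- The value of `ε_i` in terms of multiplicities. -/
noncomputable def epsCount (i : ℤ) (w : Word) : ℕ :=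
  if i ≤ 0 then (if 0 < w.count i ∧ w.count (i - 1) = 0 then 1 else 0) else w.count i

/-- The value of `φ_i` in terms of multiplicities. -/
noncomputable def phiCount (i : ℤ) (w : Word) : ℕ :=
  if i < 0 then (if 0 < w.count (i - 1) ∧ w.count i = 0 then 1 else 0) else w.count (i - 1)

theorem Lowers.epsCount_eq {i : ℤ} {w w' : Word} (h : Lowers i w w') :
    epsCount i w = epsCount i w' + 1 := by
  have h1 := h.count_eq i
  have h2 := h.count_eq (i - 1)
  simp only [if_true, show i - 1 ≠ i by omega, show i ≠ i - 1 by omega, if_false] at h1 h2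
  have h3 : i ≤ 0 → w'.count (i - 1) ≤ 1 := fun hi => w'.count_le_one (by omega)
  unfold epsCount
  split_ifs <;> omega

theorem Lowers.phiCount_eq {i : ℤ} {w w' : Word} (h : Lowers i w w') :
    phiCount i w' = phiCount i w + 1 := by
  have h1 := h.count_eq i
  have h2 := h.count_eq (i - 1)
  simp only [if_true, show i - 1 ≠ i by omega, show i ≠ i - 1 by omega, if_false] at h1 h2
  have h3 : i < 0 → w.count i ≤ 1 := w.count_le_one
  unfold phiCount
  split_ifs <;> omega

theorem exists_lowers_of_epsCount_pos {i : ℤ} {w : Word} (h : 0 < epsCount i w) :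
    ∃ w', Lowers i w w' := by
  have hpos : 0 < w.count i := by
    unfold epsCount at h; split_ifs at h <;> omega
  have hcond : i ≤ 0 → w.count (i - 1) = 0 := by
    intro hi
    unfold epsCount at h
    rw [if_pos hi] at h
    split_ifs at h with h'
    exacts [h'.2, absurd h (lt_irrefl _)]
  -- The largest index is the left-most `i`, the only one that can be lowered without breaking
  -- monotonicity.
  obtain ⟨k, hk, hmax⟩ := Set.exists_max_image {k | w.letter k = i} id (w.finite_letter_eq i)
    (count_pos.1 hpos)
  have hne : w.letter (k + 1) ≠ i := fun h' => by have := hmax (k + 1) h'; simp at this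
  have hm := w.mono k
  rw [hk] at hm
  refine ⟨w.replace k (i - 1) (by omega) ?_ ?_ ?_, k, hk, rfl⟩
  · intro h'
    by_contra hlt
    exact count_eq_zero.1 (hcond (by omega)) _ h'
  · rintro j rfl
    have := w.mono j
    rw [hk] at this
    omega
  · rintro j rfl h'
    have := w.mono j
    rw [hk] at this
    omega

theorem exists_lowers_of_phiCount_pos {i : ℤ} {w : Word} (h : 0 < phiCount i w) :
    ∃ w', Lowers i w' w := by
  have hpos : 0 < w.count (i - 1) := by
    unfold phiCount at h; split_ifs at h <;> omega
  have hcond : i < 0 → w.count i = 0 := by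
    intro hi
    unfold phiCount at h
    rw [if_pos hi] at h
    split_ifs at h with h'
    exacts [h'.2, absurd h (lt_irrefl _)]
  obtain ⟨k, hk, hmin⟩ := Set.exists_min_image {k | w.letter k = i - 1} id
    (w.finite_letter_eq (i - 1)) (count_pos.1 hpos)
  simp only [Set.mem_ofPred_eq, id] at hk hmin
  have hm := w.mono k
  rw [hk] at hm
  have hprev : ∀ j, j + 1 = k → i ≤ w.letter j := by
    rintro j rfl
    have h1 := w.mono j
    rw [hk] at h1
    have h2 : w.letter j ≠ i - 1 := fun h' => by have := hmin j h'; omega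
    omega
  refine ⟨w.replace k i (by omega) (by omega) hprev ?_, k, ?_, ?_⟩
  · intro j hj h'
    by_contra hlt
    exact count_eq_zero.1 (hcond (by omega)) j h'.symm
  · simp [replace]
  · simp [replace, ← hk]

/-- A statistic that drops by one at each application of `g`, and that is positive only where `g` is
defined, counts the possible applications. -/
theorem maxIter_eq {X : Type*} {g : X → Option X} {N : X → ℕ}
    (h0 : ∀ x, 0 < N x → g x ≠ none) (h1 : ∀ x y, g x = some y → N x = N y + 1) (x : X) :
    maxIter g x = N x := by
  have hn : ∀ k, (fun y : Option X => y.bind g)^[k] none = none := by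
    intro k
    induction k with
    | zero => rfl
    | succ k ih => rw [Function.iterate_succ_apply]; exact ih
  have key : ∀ (k : ℕ) (x : X),
      (fun y : Option X => y.bind g)^[k] (some x) ≠ none ↔ k ≤ N x := by
    intro k
    induction k with
    | zero => intro x; simp
    | succ k ih =>
      intro x
      rw [Function.iterate_succ_apply]
      simp only [Option.bind_some]
      cases hg : g x with
      | none =>
        rw [hn]
        have : ¬ 0 < N x := fun h => h0 x h hg
        simp only [ne_eq, not_true_eq_false, false_iff]
        omega
      | some y =>
        rw [ih, h1 x y hg]
        omega
  have hs : {k : ℕ | (fun y : Option X => y.bind g)^[k] (some x) ≠ none} = Set.Iic (N x) := by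
    ext k; exact key k x
  rw [maxIter, hs, csSup_Iic]

theorem crystal_eps (i : ℤ) (w : Word) : crystal.eps i w = epsCount i w := by
  refine maxIter_eq (fun w h => ?_) (fun w w' h => (eOp_eq_some_iff.1 h).epsCount_eq) w
  obtain ⟨w', hw'⟩ := exists_lowers_of_epsCount_pos h
  rw [eOp_eq_some_iff.2 hw']
  simp

theorem crystal_phi (i : ℤ) (w : Word) : crystal.phi i w = phiCount i w := by
  refine maxIter_eq (fun w h => ?_) (fun w w' h => (fOp_eq_some_iff.1 h).phiCount_eq) w
  obtain ⟨w', hw'⟩ := exists_lowers_of_phiCount_pos h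
  rw [fOp_eq_some_iff.2 hw']
  simp

theorem wt_fst (w : Word) : w.wt.1 = 1 := rfl

theorem wt_snd (w : Word) (b : ℤ) : w.wt.2 b = w.count b - if b < 0 then 1 else 0 := by
  change w.mult b = _
  simp only [mult, count, degree]
  split_ifs <;> simp_all

theorem Lowers.wt_eq {i : ℤ} {w w' : Word} (h : Lowers i w w') :
    w'.wt = w.wt + simpleRoot i := by
  refine Prod.ext ?_ (Finsupp.ext fun b => ?_)
  · simp [wt_fst, simpleRoot]
  · have := h.count_eq b
    simp only [Prod.snd_add, Finsupp.add_apply, wt_snd, simpleRoot, root_apply]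
    split_ifs at * <;> omega

theorem coroot_zero_wt (w : Word) : coroot 0 w.wt = w.count (-1) + w.count 0 := by
  simp [coroot_zero, wt_fst, wt_snd]

theorem coroot_wt {i : ℤ} (hi : i ≠ 0) (w : Word) :
    coroot i w.wt = w.count (i - 1) - w.count i := by
  rw [coroot_of_ne hi, wt_snd, wt_snd]
  split_ifs <;> omega

end Word
-- Normal crystals and their tensor products
namespace CrystalData

variable {X Y : Type*}

/-- A crystal in which `e_i b ≠ 0` if `ε_i b > 0`, and `f_i b ≠ 0` if `φ_i b > 0`. -/
structure IsNormal (C : CrystalData X) : Prop extends C.IsCrystalOn Set.univ where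
  e_ne_none : ∀ i b, 0 < C.eps i b → C.e i b ≠ none
  f_ne_none : ∀ i b, 0 < C.phi i b → C.f i b ≠ none

theorem IsCrystalOn.restrict {C : CrystalData X} (h : C.IsCrystalOn Set.univ) {S : Set X}
    (hS : C.IsStable S) : C.IsCrystalOn S where
  stable := hS
  string i hi b _ := h.string i hi b trivial
  odd_nonneg b _ := h.odd_nonneg b trivial
  odd_zero b _ := h.odd_zero b trivial
  odd_pos b _ := h.odd_pos b trivial
  e_apply i b _ := h.e_apply i b trivial
  f_apply i b _ := h.f_apply i b trivial
  f_iff_e i b _ b' _ := h.f_iff_e i b trivial b' trivial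

/-- `e_i` acts on the left factor of `x ⊗ y`. -/
def ELeft (C : CrystalData X) (D : CrystalData Y) (i : ℤ) (x : X) (y : Y) : Prop :=
  if i < 0 then D.eps i y ≤ C.phi i x
  else if 0 < i then D.phi i y < C.eps i x
  else 0 < coroot 0 (C.wt x)

/-- `f_i` acts on the left factor of `x ⊗ y`. -/
def FLeft (C : CrystalData X) (D : CrystalData Y) (i : ℤ) (x : X) (y : Y) : Prop :=
  if i < 0 then D.eps i y < C.phi i x
  else if 0 < i then D.phi i y ≤ C.eps i x
  else 0 < coroot 0 (C.wt x)

open Classical in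
theorem tensor_e (C : CrystalData X) (D : CrystalData Y) (i : ℤ) (b : X × Y) :
    (tensor C D).e i b = if ELeft C D i b.1 b.2 then (C.e i b.1).map (fun x => (x, b.2))
      else (D.e i b.2).map fun y => (b.1, y) := by
  simp only [tensor, ELeft]
  split_ifs <;> rfl

open Classical in
theorem tensor_f (C : CrystalData X) (D : CrystalData Y) (i : ℤ) (b : X × Y) :
    (tensor C D).f i b = if FLeft C D i b.1 b.2 then (C.f i b.1).map (fun x => (x, b.2))
      else (D.f i b.2).map fun y => (b.1, y) := by
  simp only [tensor, FLeft]
  split_ifs <;> rfl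

theorem tensor_e_eq_some {C : CrystalData X} {D : CrystalData Y} {i : ℤ} {x x' : X} {y y' : Y} :
    (tensor C D).e i (x, y) = some (x', y') ↔
      (ELeft C D i x y ∧ C.e i x = some x' ∧ y' = y) ∨
        (¬ ELeft C D i x y ∧ D.e i y = some y' ∧ x' = x) := by
  rw [tensor_e]
  split_ifs with h <;> simp [h, eq_comm]

theorem tensor_f_eq_some {C : CrystalData X} {D : CrystalData Y} {i : ℤ} {x x' : X} {y y' : Y} :
    (tensor C D).f i (x, y) = some (x', y') ↔
      (FLeft C D i x y ∧ C.f i x = some x' ∧ y' = y) ∨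
        (¬ FLeft C D i x y ∧ D.f i y = some y' ∧ x' = x) := by
  rw [tensor_f]
  split_ifs with h <;> simp [h, eq_comm]

/-- The string axiom for the left factor replaces the pairing by `φ_i - ε_i`; the maximum then
becomes a truncated subtraction in `ℕ`, and comparisons of factors become linear arithmetic. -/
theorem tensor_eps_of_neg {C : CrystalData X} (hC : C.IsNormal) (D : CrystalData Y) {i : ℤ}
    (hi : i < 0) (x : X) (y : Y) :
    (tensor C D).eps i (x, y) = C.eps i x + (D.eps i y - C.phi i x) := by
  have := hC.string i hi.ne x trivial
  simp only [tensor, hi, if_true]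
  omega

theorem tensor_phi_of_neg (C : CrystalData X) {D : CrystalData Y} (hD : D.IsNormal) {i : ℤ}
    (hi : i < 0) (x : X) (y : Y) :
    (tensor C D).phi i (x, y) = D.phi i y + (C.phi i x - D.eps i y) := by
  have := hD.string i hi.ne y trivial
  simp only [tensor, hi, if_true]
  omega

theorem tensor_eps_of_pos (C : CrystalData X) {D : CrystalData Y} (hD : D.IsNormal) {i : ℤ}
    (hi : 0 < i) (x : X) (y : Y) :
    (tensor C D).eps i (x, y) = D.eps i y + (C.eps i x - D.phi i y) := by
  have := hD.string i hi.ne' y trivial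
  simp only [tensor, hi, hi.not_gt, if_true, if_false]
  omega

theorem tensor_phi_of_pos {C : CrystalData X} (hC : C.IsNormal) (D : CrystalData Y) {i : ℤ}
    (hi : 0 < i) (x : X) (y : Y) :
    (tensor C D).phi i (x, y) = C.phi i x + (D.phi i y - C.eps i x) := by
  have := hC.string i hi.ne' x trivial
  simp only [tensor, hi, hi.not_gt, if_true, if_false]
  omega

theorem tensor_eps_zero (C : CrystalData X) (D : CrystalData Y) (x : X) (y : Y) :
    (tensor C D).eps 0 (x, y) = if 0 < coroot 0 (C.wt x) then C.eps 0 x else D.eps 0 y := rfl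

theorem tensor_phi_zero (C : CrystalData X) (D : CrystalData Y) (x : X) (y : Y) :
    (tensor C D).phi 0 (x, y) = if 0 < coroot 0 (C.wt x) then C.phi 0 x else D.phi 0 y := rfl

theorem tensor_wt (C : CrystalData X) (D : CrystalData Y) (x : X) (y : Y) :
    (tensor C D).wt (x, y) = C.wt x + D.wt y := rfl

/-- The root `α_0` is isotropic, so `e_0` does not change which factor colour `0` selects. -/
theorem IsCrystalOn.coroot_zero_e {C : CrystalData X} (hC : C.IsCrystalOn Set.univ) {x x' : X}
    (h : C.e 0 x = some x') : coroot 0 (C.wt x') = coroot 0 (C.wt x) := by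
  rw [(hC.e_apply 0 x trivial x' h).2.2, coroot_add, coroot_simpleRoot_zero, add_zero]

/-- The strict and weak inequalities in the rules for `e_i` and `f_i` differ by exactly the shift of
`ε_i`, `φ_i` caused by one step. Hence `f_i` selects, after the step, the factor that `e_i` selected
before it. -/
theorem tensor_e_apply {C : CrystalData X} {D : CrystalData Y} (hC : C.IsNormal)
    (hD : D.IsNormal) (i : ℤ) (b b' : X × Y) (h : (tensor C D).e i b = some b') :
    (tensor C D).eps i b = (tensor C D).eps i b' + 1 ∧
      (tensor C D).phi i b' = (tensor C D).phi i b + 1 ∧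
      (tensor C D).wt b' = (tensor C D).wt b + simpleRoot i ∧
      (tensor C D).f i b' = some b := by
  obtain ⟨x, y⟩ := b
  obtain ⟨x', y'⟩ := b'
  rw [tensor_f_eq_some]
  rw [tensor_e_eq_some] at h
  rcases h with ⟨hl, he, rfl⟩ | ⟨hl, he, rfl⟩
  · obtain ⟨h1, h2, h3⟩ := hC.e_apply i x trivial x' he
    have h4 := (hC.f_iff_e i x' trivial x trivial).2 he
    rw [tensor_wt, tensor_wt, h3]
    rcases lt_trichotomy i 0 with hi | rfl | hi
    · rw [ELeft, if_pos hi] at hl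
      rw [tensor_eps_of_neg hC _ hi, tensor_eps_of_neg hC _ hi, tensor_phi_of_neg _ hD hi,
        tensor_phi_of_neg _ hD hi]
      refine ⟨by omega, by omega, by abel, Or.inl ⟨?_, h4, rfl⟩⟩
      rw [FLeft, if_pos hi]
      omega
    · have h5 := hC.toIsCrystalOn.coroot_zero_e he
      simp only [ELeft, lt_irrefl, if_false] at hl
      simp only [tensor_eps_zero, tensor_phi_zero, FLeft, lt_irrefl, if_false, h5, hl, if_true,
        true_and]
      exact ⟨by omega, by omega, by abel, Or.inl ⟨h4, trivial⟩⟩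
    · rw [ELeft, if_neg hi.not_gt, if_pos hi] at hl
      rw [tensor_eps_of_pos _ hD hi, tensor_eps_of_pos _ hD hi, tensor_phi_of_pos hC _ hi,
        tensor_phi_of_pos hC _ hi]
      refine ⟨by omega, by omega, by abel, Or.inl ⟨?_, h4, rfl⟩⟩
      rw [FLeft, if_neg hi.not_gt, if_pos hi]
      omega
  · obtain ⟨h1, h2, h3⟩ := hD.e_apply i y trivial y' he
    have h4 := (hD.f_iff_e i y' trivial y trivial).2 he
    rw [tensor_wt, tensor_wt, h3]
    rcases lt_trichotomy i 0 with hi | rfl | hi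
    · rw [ELeft, if_pos hi] at hl
      rw [tensor_eps_of_neg hC _ hi, tensor_eps_of_neg hC _ hi, tensor_phi_of_neg _ hD hi,
        tensor_phi_of_neg _ hD hi]
      refine ⟨by omega, by omega, by abel, Or.inr ⟨?_, h4, rfl⟩⟩
      rw [FLeft, if_pos hi]
      omega
    · simp only [ELeft, lt_irrefl, if_false] at hl
      simp only [tensor_eps_zero, tensor_phi_zero, FLeft, lt_irrefl, if_false, hl]
      exact ⟨by omega, by omega, by abel, Or.inr ⟨not_false, h4, trivial⟩⟩
    · rw [ELeft, if_neg hi.not_gt, if_pos hi] at hl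
      rw [tensor_eps_of_pos _ hD hi, tensor_eps_of_pos _ hD hi, tensor_phi_of_pos hC _ hi,
        tensor_phi_of_pos hC _ hi]
      refine ⟨by omega, by omega, by abel, Or.inr ⟨?_, h4, rfl⟩⟩
      rw [FLeft, if_neg hi.not_gt, if_pos hi]
      omega

theorem tensor_e_of_f {C : CrystalData X} {D : CrystalData Y} (hC : C.IsNormal)
    (hD : D.IsNormal) (i : ℤ) (b b' : X × Y) (h : (tensor C D).f i b = some b') :
    (tensor C D).e i b' = some b := by
  obtain ⟨x, y⟩ := b
  obtain ⟨x', y'⟩ := b'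
  rw [tensor_e_eq_some]
  rw [tensor_f_eq_some] at h
  rcases h with ⟨hl, hf, rfl⟩ | ⟨hl, hf, rfl⟩
  · obtain ⟨h1, h2, h3⟩ := hC.f_apply i x trivial x' hf
    have h4 := (hC.f_iff_e i x trivial x' trivial).1 hf
    refine Or.inl ⟨?_, h4, rfl⟩
    rcases lt_trichotomy i 0 with hi | rfl | hi
    · rw [FLeft, if_pos hi] at hl
      rw [ELeft, if_pos hi]
      omega
    · simp only [FLeft, lt_irrefl, if_false] at hl
      simpa only [ELeft, lt_irrefl, if_false, ← hC.toIsCrystalOn.coroot_zero_e h4] using hl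
    · rw [FLeft, if_neg hi.not_gt, if_pos hi] at hl
      rw [ELeft, if_neg hi.not_gt, if_pos hi]
      omega
  · obtain ⟨h1, h2, h3⟩ := hD.f_apply i y trivial y' hf
    have h4 := (hD.f_iff_e i y trivial y' trivial).1 hf
    refine Or.inr ⟨?_, h4, rfl⟩
    rcases lt_trichotomy i 0 with hi | rfl | hi
    · rw [FLeft, if_pos hi] at hl
      rw [ELeft, if_pos hi]
      omega
    · simpa only [FLeft, ELeft, lt_irrefl, if_false] using hl
    · rw [FLeft, if_neg hi.not_gt, if_pos hi] at hl
      rw [ELeft, if_neg hi.not_gt, if_pos hi]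
      omega

theorem IsNormal.tensor {C : CrystalData X} {D : CrystalData Y} (hC : C.IsNormal)
    (hD : D.IsNormal) : (tensor C D).IsNormal where
  stable _ _ _ := ⟨fun _ _ => trivial, fun _ _ => trivial⟩
  string i hi b _ := by
    obtain ⟨x, y⟩ := b
    have h1 := hC.string i hi x trivial
    have h2 := hD.string i hi y trivial
    rw [tensor_wt, coroot_add, ← h1, ← h2]
    rcases hi.lt_or_gt with hi | hi
    · rw [tensor_eps_of_neg hC _ hi, tensor_phi_of_neg _ hD hi]
      omega
    · rw [tensor_eps_of_pos _ hD hi, tensor_phi_of_pos hC _ hi]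
      omega
  odd_nonneg b _ := by
    obtain ⟨x, y⟩ := b
    have h1 := hC.odd_nonneg x trivial
    have h2 := hD.odd_nonneg y trivial
    rw [tensor_wt, coroot_add]
    omega
  odd_zero b _ h := by
    obtain ⟨x, y⟩ := b
    have h1 := hC.odd_nonneg x trivial
    have h2 := hD.odd_nonneg y trivial
    rw [tensor_wt, coroot_add] at h
    rw [tensor_eps_zero, tensor_phi_zero, if_neg (by omega), if_neg (by omega)]
    exact hD.odd_zero y trivial (by omega)
  odd_pos b _ h := by
    obtain ⟨x, y⟩ := b
    have h1 := hC.odd_nonneg x trivial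
    rw [tensor_wt, coroot_add] at h
    rw [tensor_eps_zero, tensor_phi_zero]
    split_ifs with hx
    · exact hC.odd_pos x trivial hx
    · exact hD.odd_pos y trivial (by omega)
  e_apply i b _ b' h := by
    have := tensor_e_apply hC hD i b b' h
    exact ⟨by omega, this.2.1, this.2.2.1⟩
  f_apply i b _ b' h := by
    have := tensor_e_apply hC hD i b' b (tensor_e_of_f hC hD i b b' h)
    exact ⟨by omega, by omega, eq_sub_of_add_eq this.2.2.1.symm⟩
  f_iff_e i b _ b' _ :=
    ⟨tensor_e_of_f hC hD i b b', fun h => (tensor_e_apply hC hD i b' b h).2.2.2⟩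
  e_ne_none i b h := by
    obtain ⟨x, y⟩ := b
    -- Positivity of `ε_i` on the product is positivity on the very factor that the rule selects, so
    -- normality of that factor applies.
    have key : (ELeft C D i x y → 0 < C.eps i x) ∧ (¬ ELeft C D i x y → 0 < D.eps i y) := by
      rcases lt_trichotomy i 0 with hi | rfl | hi
      · rw [tensor_eps_of_neg hC _ hi] at h
        rw [ELeft, if_pos hi]
        omega
      · rw [tensor_eps_zero] at h
        simp only [ELeft, lt_irrefl, if_false]
        split_ifs at h with hx <;> simp [hx, h]
      · rw [tensor_eps_of_pos _ hD hi] at h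
        rw [ELeft, if_neg hi.not_gt, if_pos hi]
        omega
    rw [tensor_e]
    split_ifs with hl
    · simpa using hC.e_ne_none i x (key.1 hl)
    · simpa using hD.e_ne_none i y (key.2 hl)
  f_ne_none i b h := by
    obtain ⟨x, y⟩ := b
    have key : (FLeft C D i x y → 0 < C.phi i x) ∧ (¬ FLeft C D i x y → 0 < D.phi i y) := by
      rcases lt_trichotomy i 0 with hi | rfl | hi
      · rw [tensor_phi_of_neg _ hD hi] at h
        rw [FLeft, if_pos hi]
        omega
      · rw [tensor_phi_zero] at h
        simp only [FLeft, lt_irrefl, if_false]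
        split_ifs at h with hx <;> simp [hx, h]
      · rw [tensor_phi_of_pos hC _ hi] at h
        rw [FLeft, if_neg hi.not_gt, if_pos hi]
        omega
    rw [tensor_f]
    split_ifs with hl
    · simpa using hC.f_ne_none i x (key.1 hl)
    · simpa using hD.f_ne_none i y (key.2 hl)

theorem isNormal_unit (X : Type*) : (unit X).IsNormal where
  stable _ _ _ := ⟨fun _ _ => trivial, fun _ _ => trivial⟩
  string i _ _ _ := by simp [unit, coroot_weight_zero]
  odd_nonneg _ _ := by simp [unit, coroot_weight_zero]
  odd_zero _ _ _ := rfl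
  odd_pos _ _ h := by simp [unit, coroot_weight_zero] at h
  e_apply _ _ _ _ h := by simp [unit] at h
  f_apply _ _ _ _ h := by simp [unit] at h
  f_iff_e _ _ _ _ _ := by simp [unit]
  e_ne_none _ _ h := by simp [unit] at h
  f_ne_none _ _ h := by simp [unit] at h

theorem transport_e_eq_some {C : CrystalData X} {g : X ≃ Y} {i : ℤ} {y y' : Y} :
    (C.transport g).e i y = some y' ↔ C.e i (g.symm y) = some (g.symm y') := by
  simp only [transport, Option.map_eq_some_iff]
  exact ⟨fun ⟨a, h, h'⟩ => by rw [h, ← h', g.symm_apply_apply],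
    fun h => ⟨_, h, g.apply_symm_apply _⟩⟩

theorem transport_f_eq_some {C : CrystalData X} {g : X ≃ Y} {i : ℤ} {y y' : Y} :
    (C.transport g).f i y = some y' ↔ C.f i (g.symm y) = some (g.symm y') := by
  simp only [transport, Option.map_eq_some_iff]
  exact ⟨fun ⟨a, h, h'⟩ => by rw [h, ← h', g.symm_apply_apply],
    fun h => ⟨_, h, g.apply_symm_apply _⟩⟩

theorem IsNormal.transport {C : CrystalData X} (hC : C.IsNormal) (g : X ≃ Y) :
    (C.transport g).IsNormal where
  stable _ _ _ := ⟨fun _ _ => trivial, fun _ _ => trivial⟩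
  string i hi b _ := hC.string i hi _ trivial
  odd_nonneg _ _ := hC.odd_nonneg _ trivial
  odd_zero _ _ := hC.odd_zero _ trivial
  odd_pos _ _ := hC.odd_pos _ trivial
  e_apply i b _ b' h := hC.e_apply i _ trivial _ (transport_e_eq_some.1 h)
  f_apply i b _ b' h := hC.f_apply i _ trivial _ (transport_f_eq_some.1 h)
  f_iff_e i b _ b' _ := by
    rw [transport_e_eq_some, transport_f_eq_some]
    exact hC.f_iff_e i _ trivial _ trivial
  e_ne_none i b h := by simpa [CrystalData.transport] using hC.e_ne_none i _ h
  f_ne_none i b h := by simpa [CrystalData.transport] using hC.f_ne_none i _ h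

theorem IsNormal.tensorPow {C : CrystalData X} (hC : C.IsNormal) : ∀ u, (C.tensorPow u).IsNormal
  | 0 => isNormal_unit _
  | u + 1 => (hC.tensor (hC.tensorPow u)).transport _

/-! ### Tensor powers: locating the factor acted upon -/

theorem tensorPow_wt (C : CrystalData X) {u : ℕ} (w : Fin u → X) :
    (C.tensorPow u).wt w = ∑ j, C.wt (w j) := by
  induction u with
  | zero => rfl
  | succ u ih =>
    rw [Fin.sum_univ_succ]
    exact congrArg (C.wt (w 0) + ·) (ih (Fin.tail w))

theorem tensorPow_eps_succ (C : CrystalData X) {u : ℕ} (i : ℤ) (w : Fin (u + 1) → X) :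
    (C.tensorPow (u + 1)).eps i w = (tensor C (C.tensorPow u)).eps i (w 0, Fin.tail w) := rfl

theorem tensorPow_phi_succ (C : CrystalData X) {u : ℕ} (i : ℤ) (w : Fin (u + 1) → X) :
    (C.tensorPow (u + 1)).phi i w = (tensor C (C.tensorPow u)).phi i (w 0, Fin.tail w) := rfl

theorem tensorPow_e_succ {C : CrystalData X} {u : ℕ} {i : ℤ} {w w' : Fin (u + 1) → X} :
    (C.tensorPow (u + 1)).e i w = some w' ↔
      (tensor C (C.tensorPow u)).e i (w 0, Fin.tail w) = some (w' 0, Fin.tail w') :=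
  transport_e_eq_some

theorem tensorPow_f_succ {C : CrystalData X} {u : ℕ} {i : ℤ} {w w' : Fin (u + 1) → X} :
    (C.tensorPow (u + 1)).f i w = some w' ↔
      (tensor C (C.tensorPow u)).f i (w 0, Fin.tail w) = some (w' 0, Fin.tail w') :=
  transport_f_eq_some

/-- For `i < 0`, `ε_i` of a product is at least `ε_i` of its first factor; for `i > 0` the same
holds for `φ_i`. Beating the whole product thus implies beating its first factor. -/
theorem ELeft.head {C : CrystalData X} (hC : C.IsNormal) {u : ℕ} {i : ℤ} {x : X}
    {w : Fin (u + 1) → X} (h : ELeft C (C.tensorPow (u + 1)) i x w) : ELeft C C i x (w 0) := by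
  rcases lt_trichotomy i 0 with hi | rfl | hi
  · rw [ELeft, if_pos hi, tensorPow_eps_succ, tensor_eps_of_neg hC _ hi] at h
    rw [ELeft, if_pos hi]
    omega
  · exact h
  · rw [ELeft, if_neg hi.not_gt, if_pos hi, tensorPow_phi_succ, tensor_phi_of_pos hC _ hi] at h
    rw [ELeft, if_neg hi.not_gt, if_pos hi]
    omega

theorem FLeft.head {C : CrystalData X} (hC : C.IsNormal) {u : ℕ} {i : ℤ} {x : X}
    {w : Fin (u + 1) → X} (h : FLeft C (C.tensorPow (u + 1)) i x w) : FLeft C C i x (w 0) := by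
  rcases lt_trichotomy i 0 with hi | rfl | hi
  · rw [FLeft, if_pos hi, tensorPow_eps_succ, tensor_eps_of_neg hC _ hi] at h
    rw [FLeft, if_pos hi]
    omega
  · exact h
  · rw [FLeft, if_neg hi.not_gt, if_pos hi, tensorPow_phi_succ, tensor_phi_of_pos hC _ hi] at h
    rw [FLeft, if_neg hi.not_gt, if_pos hi]
    omega

/-- If `e_i` acts on the first factor of `w`, the truncated difference vanishes, and `w` compares
with `x` exactly as its first factor does. -/
theorem ELeft.of_head {C : CrystalData X} (hC : C.IsNormal) {u : ℕ} {i : ℤ} {x : X}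
    {w : Fin (u + 1) → X} (hw : ELeft C (C.tensorPow u) i (w 0) (Fin.tail w))
    (h : ELeft C C i x (w 0)) : ELeft C (C.tensorPow (u + 1)) i x w := by
  rcases lt_trichotomy i 0 with hi | rfl | hi
  · rw [ELeft, if_pos hi] at h hw
    rw [ELeft, if_pos hi, tensorPow_eps_succ, tensor_eps_of_neg hC _ hi]
    omega
  · exact h
  · rw [ELeft, if_neg hi.not_gt, if_pos hi] at h hw
    rw [ELeft, if_neg hi.not_gt, if_pos hi, tensorPow_phi_succ, tensor_phi_of_pos hC _ hi]
    omega

theorem FLeft.of_head {C : CrystalData X} (hC : C.IsNormal) {u : ℕ} {i : ℤ} {x : X}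
    {w : Fin (u + 1) → X} (hw : FLeft C (C.tensorPow u) i (w 0) (Fin.tail w))
    (h : FLeft C C i x (w 0)) : FLeft C (C.tensorPow (u + 1)) i x w := by
  rcases lt_trichotomy i 0 with hi | rfl | hi
  · rw [FLeft, if_pos hi] at h hw
    rw [FLeft, if_pos hi, tensorPow_eps_succ, tensor_eps_of_neg hC _ hi]
    omega
  · exact h
  · rw [FLeft, if_neg hi.not_gt, if_pos hi] at h hw
    rw [FLeft, if_neg hi.not_gt, if_pos hi, tensorPow_phi_succ, tensor_phi_of_pos hC _ hi]
    omega

/-- `w'` arises from `w` by letting a partial map `g` act on the factor at `j`; the relation `R`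
holds between this factor and the next one, but not between the previous one and this factor. -/
structure ActsAt {u : ℕ} (g : X → Option X) (R : X → X → Prop) (w w' : Fin u → X) (j : Fin u) :
    Prop where
  map_eq : g (w j) = some (w' j)
  eq_of_ne : ∀ k, k ≠ j → w' k = w k
  next : ∀ k : Fin u, (k : ℕ) = j + 1 → R (w j) (w k)
  prev : ∀ k : Fin u, (j : ℕ) = k + 1 → ¬ R (w k) (w j)

theorem ActsAt.zero {u : ℕ} {g : X → Option X} {R : X → X → Prop} {w w' : Fin (u + 1) → X}
    (h : g (w 0) = some (w' 0)) (ht : Fin.tail w' = Fin.tail w)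
    (hR : ∀ k : Fin (u + 1), (k : ℕ) = 1 → R (w 0) (w k)) : ActsAt g R w w' 0 where
  map_eq := h
  eq_of_ne k hk := by
    obtain ⟨k, rfl⟩ := Fin.exists_succ_eq.2 hk
    exact congrFun ht k
  next k hk := hR k (by simpa using hk)
  prev k hk := by simp at hk

theorem ActsAt.succ {u : ℕ} {g : X → Option X} {R : X → X → Prop} {w w' : Fin (u + 1) → X}
    {j : Fin u} (h : ActsAt g R (Fin.tail w) (Fin.tail w') j) (h0 : w' 0 = w 0)
    (hR : (j : ℕ) = 0 → ¬ R (w 0) (w j.succ)) : ActsAt g R w w' j.succ where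
  map_eq := h.map_eq
  eq_of_ne k hk := by
    cases k using Fin.cases with
    | zero => exact h0
    | succ k => exact h.eq_of_ne k (fun h => hk (congrArg _ h))
  next k hk := by
    cases k using Fin.cases with
    | zero => simp at hk
    | succ k => exact h.next k (by simpa using hk)
  prev k hk := by
    cases k using Fin.cases with
    | zero => exact hR (by simpa using hk)
    | succ k => exact h.prev k (by simpa using hk)

/-- The clause for `j = 0` strengthens the induction: when the action falls on the head of the tail,
it turns the failure of `ELeft` against the whole tail into failure against that head, as the field
`prev` requires. -/
theorem exists_actsAt_of_e {C : CrystalData X} (hC : C.IsNormal) {i : ℤ} {u : ℕ}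
    {w w' : Fin u → X} (h : (C.tensorPow u).e i w = some w') :
    ∃ j, ActsAt (C.e i) (ELeft C C i) w w' j ∧
      ((j : ℕ) = 0 → ∀ x, ELeft C C i x (w j) → ELeft C (C.tensorPow u) i x w) := by
  induction u with
  | zero => simp [tensorPow, unit] at h
  | succ u ih =>
    rw [tensorPow_e_succ, tensor_e_eq_some] at h
    rcases h with ⟨hl, he, ht⟩ | ⟨hl, he, h0⟩
    · refine ⟨0, ActsAt.zero he ht fun k hk => ?_, fun _ x hx => hl.of_head hC hx⟩
      cases u with
      | zero => omega
      | succ u =>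
        obtain rfl : k = (0 : Fin (u + 1)).succ := Fin.ext hk
        exact hl.head hC
    · obtain ⟨j, hj, hj0⟩ := ih he
      exact ⟨j.succ, hj.succ h0 fun hz hx => hl (hj0 hz _ hx), fun hz => by simp at hz⟩

theorem exists_actsAt_of_f {C : CrystalData X} (hC : C.IsNormal) {i : ℤ} {u : ℕ}
    {w w' : Fin u → X} (h : (C.tensorPow u).f i w = some w') :
    ∃ j, ActsAt (C.f i) (FLeft C C i) w w' j ∧
      ((j : ℕ) = 0 → ∀ x, FLeft C C i x (w j) → FLeft C (C.tensorPow u) i x w) := by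
  induction u with
  | zero => simp [tensorPow, unit] at h
  | succ u ih =>
    rw [tensorPow_f_succ, tensor_f_eq_some] at h
    rcases h with ⟨hl, he, ht⟩ | ⟨hl, he, h0⟩
    · refine ⟨0, ActsAt.zero he ht fun k hk => ?_, fun _ x hx => hl.of_head hC hx⟩
      cases u with
      | zero => omega
      | succ u =>
        obtain rfl : k = (0 : Fin (u + 1)).succ := Fin.ext hk
        exact hl.head hC
    · obtain ⟨j, hj, hj0⟩ := ih he
      exact ⟨j.succ, hj.succ h0 fun hz hx => hl (hj0 hz _ hx), fun hz => by simp at hz⟩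

/-- For `i > 0`, a factor with `ε_i > 0` all of whose successors have nonpositive `⟨h_i, wt⟩`
makes `ε_i` of the tensor product positive. -/
theorem tensorPow_eps_pos {C : CrystalData X} (hC : C.IsNormal) {i : ℤ} (hi : 0 < i) {u : ℕ}
    (w : Fin u → X) (j : Fin u) (hj : 0 < C.eps i (w j))
    (h : ∀ k, j < k → coroot i (C.wt (w k)) ≤ 0) : 0 < (C.tensorPow u).eps i w := by
  induction u with
  | zero => exact j.elim0
  | succ u ih =>
    rw [tensorPow_eps_succ, tensor_eps_of_pos _ (hC.tensorPow u) hi]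
    cases j using Fin.cases with
    | zero =>
      -- So `φ_i ≤ ε_i` on the tail: either `ε_i` of the tail is positive, or its `φ_i` is zero and
      -- the head contributes all of its `ε_i`.
      have h1 : coroot i ((C.tensorPow u).wt (Fin.tail w)) ≤ 0 := by
        rw [tensorPow_wt, ← AddMonoidHom.mk'_apply (coroot i) (coroot_add i), map_sum]
        exact Finset.sum_nonpos fun k _ => h k.succ k.succ_pos
      rw [← (hC.tensorPow u).string i hi.ne' _ trivial] at h1
      omega
    | succ j =>
      have := ih (Fin.tail w) j hj fun k hk => h k.succ (Fin.succ_lt_succ_iff.2 hk)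
      omega

end CrystalData

/-! ### Normality of the crystal of words -/

namespace Word

theorem isNormal_crystal : crystal.IsNormal where
  stable _ _ _ := ⟨fun _ _ => trivial, fun _ _ => trivial⟩
  string i hi w _ := by
    rw [crystal_eps, crystal_phi]
    change _ = coroot i w.wt
    rw [coroot_wt hi]
    have h1 : i < 0 → w.count i ≤ 1 := w.count_le_one
    have h2 : i < 0 → w.count (i - 1) ≤ 1 := fun _ => w.count_le_one (by omega)
    unfold epsCount phiCount
    split_ifs <;> omega
  odd_nonneg w _ := by
    change 0 ≤ coroot 0 w.wt
    rw [coroot_zero_wt]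
    omega
  odd_zero w _ h := by
    change coroot 0 w.wt = 0 at h
    rw [coroot_zero_wt] at h
    rw [crystal_eps, crystal_phi]
    simp only [epsCount, phiCount, lt_irrefl, le_refl, if_true, if_false, zero_sub]
    split_ifs <;> omega
  odd_pos w _ h := by
    change 0 < coroot 0 w.wt at h
    rw [coroot_zero_wt] at h
    rw [crystal_eps, crystal_phi]
    simp only [epsCount, phiCount, lt_irrefl, le_refl, if_true, if_false, zero_sub]
    have := w.count_le_one (b := -1) (by omega)
    split_ifs <;> omega
  e_apply i w _ w' h := by
    have h := eOp_eq_some_iff.1 h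
    rw [crystal_eps, crystal_eps, crystal_phi, crystal_phi, h.epsCount_eq, h.phiCount_eq]
    exact ⟨by omega, rfl, h.wt_eq⟩
  f_apply i w _ w' h := by
    have h := fOp_eq_some_iff.1 h
    rw [crystal_eps, crystal_eps, crystal_phi, crystal_phi, h.epsCount_eq, h.phiCount_eq]
    exact ⟨rfl, by omega, eq_sub_of_add_eq h.wt_eq.symm⟩
  f_iff_e i w _ w' _ := fOp_eq_some_iff.trans eOp_eq_some_iff.symm
  e_ne_none i w h := by
    rw [crystal_eps] at h
    obtain ⟨w', hw'⟩ := exists_lowers_of_epsCount_pos h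
    exact fun h' => by simp [crystal, eOp_eq_some_iff.2 hw'] at h'
  f_ne_none i w h := by
    rw [crystal_phi] at h
    obtain ⟨w', hw'⟩ := exists_lowers_of_phiCount_pos h
    exact fun h' => by simp [crystal, fOp_eq_some_iff.2 hw'] at h'

end Word

/-! ### Adjacent columns and stability of tableaux -/

theorem degree_eq_zero {b : ℤ} : degree b = 0 ↔ b < 0 := by
  unfold degree; split_ifs with h <;> simp [h]

namespace Word

theorem Lowers.hasCharge_iff {i : ℤ} {w w' : Word} (h : Lowers i w w') (c : ℤ) :
    HasCharge w'.letter c ↔ HasCharge w.letter c := by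
  obtain ⟨k, -, h⟩ := h
  refine Filter.eventually_congr ?_
  filter_upwards [Filter.eventually_gt_atTop k] with l hl
  rw [h, Function.update_of_ne hl.ne']

/-- The condition for `x`, `y` to be adjacent columns of a tableau, with charges differing
by `d`. -/
def Adjacent (d : ℕ) (x y : Word) : Prop :=
  ∀ k, y.letter (k + d) ≤ x.letter k ∧ (x.letter k = y.letter (k + d) → degree (x.letter k) = 0)

theorem Adjacent.lt_or {d : ℕ} {x y : Word} (h : Adjacent d x y) (k : ℕ) :
    y.letter (k + d) < x.letter k ∨ y.letter (k + d) = x.letter k ∧ x.letter k < 0 := by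
  obtain ⟨h1, h2⟩ := h k
  rw [degree_eq_zero] at h2
  omega

theorem adjacent_iff {d : ℕ} {x y : Word} : Adjacent d x y ↔
    ∀ k, y.letter (k + d) < x.letter k ∨ y.letter (k + d) = x.letter k ∧ x.letter k < 0 := by
  refine ⟨fun h => h.lt_or, fun h k => ?_⟩
  have := h k
  rw [degree_eq_zero]
  omega

open CrystalData

theorem Adjacent.e_right {d : ℕ} {i : ℤ} {x y y' : Word} (h : Adjacent d x y)
    (hy : Lowers i y y') : Adjacent d x y' := by
  obtain ⟨l, hl, hy⟩ := hy
  rw [adjacent_iff] at h ⊢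
  intro k
  have := h k
  rcases eq_or_ne (k + d) l with hk | hk
  · rw [hy, hk, Function.update_self]
    rw [hk] at this
    omega
  · rwa [hy, Function.update_of_ne hk]

theorem Adjacent.f_left {d : ℕ} {i : ℤ} {x x' y : Word} (h : Adjacent d x y)
    (hx : Lowers i x' x) : Adjacent d x' y := by
  obtain ⟨l, hl, hx⟩ := hx
  obtain ⟨hl, hx⟩ := Lowers.eq_update hl hx
  rw [adjacent_iff] at h ⊢
  intro k
  have := h k
  rcases eq_or_ne k l with rfl | hk
  · rw [hx, Function.update_self]
    omega
  · rwa [hx, Function.update_of_ne hk]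

/-- Only the row of the changed letter can go wrong. A bad neighbour would be `i` if `i < 0`, or `i
- 1` if `i > 0`; for `i = 0` there is none. In both cases the multiplicities then contradict
`ELeft`. -/
theorem Adjacent.e_left {d : ℕ} {i : ℤ} {x x' y : Word} (h : Adjacent d x y)
    (hx : Lowers i x x') (hl : ELeft crystal crystal i x y) : Adjacent d x' y := by
  obtain ⟨k, hk, hx⟩ := hx
  have hk' := (Lowers.eq_update hk hx).1
  have hnext : ∀ t, k < t → x.letter t ≤ i - 1 ∧ (i ≤ 0 → x.letter t < i - 1) := by
    intro t ht
    have : x.letter t = x'.letter t := by rw [hx, Function.update_of_ne ht.ne']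
    rw [this, ← hk']
    exact ⟨x'.antitone ht.le, fun hi => x'.letter_lt ht (by omega)⟩
  rw [adjacent_iff] at h ⊢
  intro t
  have ht := h t
  rcases eq_or_ne t k with rfl | htk
  · rw [hk']
    rcases lt_trichotomy i 0 with hi | rfl | hi
    · rw [ELeft, if_pos hi, crystal_eps, crystal_phi] at hl
      by_contra hcon
      -- Here `φ_i(x) = 0`, so `ELeft` gives `ε_i(y) = 0` and `y` must also contain `i - 1`. Then
      -- `y` has a letter at least `i - 1` in the row just to the left, where `x` is below `i - 1`.
      have hyi : y.letter (t + d) = i := by omega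
      have hx0 : x.count (i - 1) = 0 := by
        rw [count_eq_zero]
        intro s hs
        rcases lt_or_ge t s with hts | hts
        · have := (hnext s hts).2 hi.le
          omega
        · have := x.antitone hts
          omega
      have hy1 : 0 < y.count i := count_pos.2 ⟨_, hyi⟩
      have hy2 : 0 < y.count (i - 1) := by
        by_contra hcon
        simp only [phiCount, epsCount, hi, hi.le, if_true, hx0, hy1, true_and] at hl
        split_ifs at hl <;> omega
      obtain ⟨s, hs⟩ := count_pos.1 hy2
      have hts : t + d < s := by
        by_contra hcon
        have := y.antitone (not_lt.1 hcon)
        omega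
      have h1 := y.antitone (show t + 1 + d ≤ s by omega)
      have h2 := h (t + 1)
      have h3 := (hnext (t + 1) (by omega)).2 hi.le
      omega
    · omega
    · rw [ELeft, if_neg hi.not_gt, if_pos hi, crystal_eps, crystal_phi, epsCount, phiCount,
        if_neg hi.not_gt, if_neg hi.not_ge] at hl
      by_contra hcon
      have hyi : y.letter (t + d) = i - 1 := by omega
      -- Moving along rows sends each `i` of `x` to an `i - 1` of `y`, so `ε_i(x) ≤ φ_i(y)`.
      refine hl.not_ge (Set.ncard_le_ncard_of_injOn (· + d) ?_
        (add_left_injective d).injOn (y.finite_letter_eq _))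
      intro s hs
      simp only [Set.mem_ofPred_eq] at hs ⊢
      have hst : s ≤ t := by
        by_contra hst
        have := (hnext s (by omega)).1
        omega
      have h1 := y.antitone (show s + d ≤ t + d by omega)
      have h2 := h s
      omega
  · rwa [hx, Function.update_of_ne htk]

/-- Dual to `Adjacent.e_left`, except that colour `0` now needs the rule: since `f_0` does not act
on `x`, the column `x` contains neither `-1` nor `0`. -/
theorem Adjacent.f_right {d : ℕ} {i : ℤ} {x y y' : Word} (h : Adjacent d x y)
    (hy : Lowers i y' y) (hl : ¬ FLeft crystal crystal i x y) : Adjacent d x y' := by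
  obtain ⟨k, hk', hy⟩ := hy
  obtain ⟨hk, hy⟩ := Lowers.eq_update hk' hy
  have hprev : ∀ t, t < k → i ≤ y.letter t ∧ (i < 0 → i < y.letter t) := by
    intro t ht
    have : y.letter t = y'.letter t := by rw [hy, Function.update_of_ne ht.ne]
    rw [this]
    have h1 := y'.antitone ht.le
    refine ⟨by omega, fun hi => ?_⟩
    by_contra hlt
    have := y'.letter_lt ht (by omega)
    omega
  rw [adjacent_iff] at h ⊢
  intro t
  have ht := h t
  rcases eq_or_ne (t + d) k with rfl | htk
  · rw [hk']
    rcases lt_trichotomy i 0 with hi | rfl | hi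
    · rw [FLeft, if_pos hi, crystal_eps, crystal_phi] at hl
      by_contra hcon
      have hxi : x.letter t = i - 1 := by omega
      have hy0 : y.count i = 0 := by
        rw [count_eq_zero]
        intro s hs
        rcases lt_or_ge s (t + d) with hts | hts
        · have := (hprev s hts).2 hi
          omega
        · have := y.antitone hts
          omega
      have hx1 : 0 < x.count (i - 1) := count_pos.2 ⟨_, hxi⟩
      have hx2 : 0 < x.count i := by
        by_contra hcon
        simp only [phiCount, epsCount, hi, hi.le, if_true] at hl
        split_ifs at hl <;> omega
      obtain ⟨s, hs⟩ := count_pos.1 hx2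
      have hts : s < t := by
        by_contra hcon
        have := x.antitone (not_lt.1 hcon)
        omega
      have h1 := x.antitone (show s ≤ t - 1 by omega)
      have h2 := h (t - 1)
      have h3 := (hprev (t - 1 + d) (by omega)).2 hi
      omega
    · simp only [FLeft, lt_irrefl, if_false] at hl
      change ¬ 0 < coroot 0 x.wt at hl
      rw [coroot_zero_wt] at hl
      have h1 := count_eq_zero.1 (show x.count (-1) = 0 by omega) t
      have h2 := count_eq_zero.1 (show x.count 0 = 0 by omega) t
      omega
    · rw [FLeft, if_neg hi.not_gt, if_pos hi, crystal_eps, crystal_phi, epsCount, phiCount,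
        if_neg hi.not_gt, if_neg hi.not_ge] at hl
      by_contra hcon
      have hxi : x.letter t = i := by omega
      have hge : ∀ s, y.letter s = i - 1 → t + d ≤ s := by
        intro s hs
        by_contra hst
        have := (hprev s (by omega)).1
        omega
      refine hl (Set.ncard_le_ncard_of_injOn (· - d) ?_ ?_ (x.finite_letter_eq _))
      · intro s hs
        simp only [Set.mem_ofPred_eq] at hs ⊢
        have hst := hge s hs
        have h1 := x.antitone (show t ≤ s - d by omega)
        have h2 := h (s - d)
        rw [Nat.sub_add_cancel (by omega)] at h2
        omega
      · intro s hs s' hs' hss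
        have := hge s hs
        have := hge s' hs'
        simp only at hss
        omega
  · rwa [hy, Function.update_of_ne htk]

end Word

open Word CrystalData

theorem mem_tableaux {u : ℕ} {lam : Fin u → ℤ} {w : Fin u → Word} : w ∈ tableaux lam ↔
    (∀ i, HasCharge (w i).letter (lam i)) ∧
      ∀ i j : Fin u, (j : ℕ) = i + 1 → Adjacent (lam i - lam j).toNat (w i) (w j) := Iff.rfl

/-- If `w'` arises from `w` by an operator acting at the column `j` and this preserves the charge
and the adjacency to both neighbours, then `w'` is a tableau. -/
theorem mem_tableaux_of_actsAt {u : ℕ} {lam : Fin u → ℤ} {w w' : Fin u → Word}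
    (hw : w ∈ tableaux lam) {g : Word → Option Word} {R : Word → Word → Prop} {j : Fin u}
    (h : ActsAt g R w w' j)
    (hc : ∀ c, HasCharge (w j).letter c → HasCharge (w' j).letter c)
    (hl : ∀ d y, Adjacent d (w j) y → R (w j) y → Adjacent d (w' j) y)
    (hr : ∀ d x, Adjacent d x (w j) → ¬ R x (w j) → Adjacent d x (w' j)) : w' ∈ tableaux lam := by
  rw [mem_tableaux] at hw ⊢
  refine ⟨fun k => ?_, fun k l hkl => ?_⟩
  · rcases eq_or_ne k j with rfl | hk
    · exact hc _ (hw.1 k)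
    · rw [h.eq_of_ne k hk]
      exact hw.1 k
  · have hw := hw.2 k l hkl
    rcases eq_or_ne k j with rfl | hk
    · rw [h.eq_of_ne l (by rintro rfl; omega)]
      exact hl _ _ hw (h.next l hkl)
    · rw [h.eq_of_ne k hk]
      rcases eq_or_ne l j with rfl | hl
      · exact hr _ _ hw (h.prev k hkl)
      · rwa [h.eq_of_ne l hl]

theorem isStable_tableaux {u : ℕ} (lam : Fin u → ℤ) :
    (crystal.tensorPow u).IsStable (tableaux lam) := by
  refine fun i w hw => ⟨fun w' h => ?_, fun w' h => ?_⟩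
  · obtain ⟨j, hj, -⟩ := exists_actsAt_of_e isNormal_crystal h
    have hlow : Lowers i (w j) (w' j) := eOp_eq_some_iff.1 hj.map_eq
    exact mem_tableaux_of_actsAt hw hj (fun c => (hlow.hasCharge_iff c).2)
      (fun d y hy hR => hy.e_left hlow hR) (fun d x hx _ => hx.e_right hlow)
  · obtain ⟨j, hj, -⟩ := exists_actsAt_of_f isNormal_crystal h
    have hlow : Lowers i (w' j) (w j) := fOp_eq_some_iff.1 hj.map_eq
    exact mem_tableaux_of_actsAt hw hj (fun c => (hlow.hasCharge_iff c).1)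
      (fun d y hy _ => hy.f_left hlow) (fun d x hx hR => hx.f_right hlow hR)


/-! ### Letterwise order, weights and heights -/

/-- The height of a weight: the additive function with value `-b` at `ε_b` and `0` at `Λ`. -/
noncomputable def height : Weight →+ ℤ :=
  (Finsupp.liftAddHom fun b => AddMonoidHom.mulLeft (-b)).comp (AddMonoidHom.snd ℤ (ℤ →₀ ℤ))

theorem height_single_sub (a b : ℤ) :
    height (0, Finsupp.single a 1 - Finsupp.single b 1) = b - a := by
  simp only [height, AddMonoidHom.comp_apply, AddMonoidHom.coe_snd, map_sub,
    Finsupp.liftAddHom_apply_single, AddMonoidHom.coe_mulLeft]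
  ring

theorem height_simpleRoot (i : ℤ) : height (simpleRoot i) = 1 := by
  rw [simpleRoot, root, height_single_sub]
  ring

theorem WeightLE.height_le {μ ν : Weight} (h : WeightLE μ ν) : height μ ≤ height ν := by
  rw [← sub_nonneg, ← map_sub]
  unfold WeightLE at h
  generalize ν - μ = x at h
  induction h using AddSubmonoid.closure_induction with
  | mem x hx =>
    obtain ⟨i, rfl⟩ := hx
    rw [height_simpleRoot]
    exact zero_le_one
  | zero => rw [map_zero]
  | add x y _ _ hx hy =>
    rw [map_add]
    exact add_nonneg hx hy

/-- The difference telescopes as `α_{a+1} + ⋯ + α_b`. -/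
theorem single_sub_mem_closure {a b : ℤ} (h : a ≤ b) :
    ((0, Finsupp.single a 1 - Finsupp.single b 1) : Weight) ∈
      AddSubmonoid.closure (Set.range simpleRoot) := by
  induction b, h using Int.leInduction with
  | base =>
    rw [sub_self]
    exact AddSubmonoid.zero_mem _
  | succ b _ ih =>
    have : ((0, Finsupp.single a 1 - Finsupp.single (b + 1) 1) : Weight) =
        (0, Finsupp.single a 1 - Finsupp.single b 1) + simpleRoot (b + 1) := by
      simp only [simpleRoot, root, add_sub_cancel_right, Prod.mk_add_mk, add_zero,
        sub_add_sub_cancel]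
    rw [this]
    exact AddSubmonoid.add_mem _ ih (AddSubmonoid.subset_closure ⟨_, rfl⟩)

namespace Word

theorem count_eq_add (w : Word) (N : ℕ) (b : ℤ) :
    (w.count b : ℤ) = (∑ k ∈ Finset.range N, if w.letter k = b then 1 else 0) +
      ({k | N ≤ k ∧ w.letter k = b}.ncard : ℤ) := by
  have hs : {k | w.letter k = b} =
      (((Finset.range N).filter fun k => w.letter k = b : Finset ℕ) : Set ℕ) ∪
        {k | N ≤ k ∧ w.letter k = b} := by
    ext k
    simp only [Set.mem_ofPred_eq, Finset.coe_filter, Finset.mem_range, Set.mem_union]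
    have := lt_or_ge k N
    tauto
  rw [count, hs, Set.ncard_union_eq ?_ (Finset.finite_toSet _)
    ((w.finite_letter_eq b).subset fun k hk => hk.2), Set.ncard_coe_finset, Finset.card_filter]
  · push_cast
    rfl
  · rw [Set.disjoint_left]
    intro k hk hk'
    simp only [Set.mem_ofPred_eq, Finset.coe_filter, Finset.mem_range] at hk hk'
    omega

theorem wt_sub_wt {v w : Word} {N : ℕ} (h : ∀ k, N ≤ k → v.letter k = w.letter k) :
    v.wt - w.wt = ∑ k ∈ Finset.range N,
      ((0, Finsupp.single (v.letter k) 1 - Finsupp.single (w.letter k) 1) : Weight) := by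
  refine Prod.ext ?_ (Finsupp.ext fun b => ?_)
  · simp [wt_fst, Prod.fst_sum]
  · rw [Prod.snd_sub, Prod.snd_sum, Finsupp.sub_apply, Finsupp.finsetSum_apply, wt_snd, wt_snd,
      count_eq_add v N, count_eq_add w N]
    have : {k | N ≤ k ∧ v.letter k = b} = {k | N ≤ k ∧ w.letter k = b} := by
      ext k
      simp only [Set.mem_ofPred_eq]
      exact and_congr_right fun hk => by rw [h k hk]
    simp only [this, Finsupp.sub_apply, Finsupp.single_apply, Finset.sum_sub_distrib]
    ring

theorem exists_letter_eq {v w : Word} {c : ℤ} (hv : HasCharge v.letter c)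
    (hw : HasCharge w.letter c) : ∃ N, ∀ k, N ≤ k → v.letter k = w.letter k := by
  refine Filter.eventually_atTop.1 ?_
  filter_upwards [hv, hw] with k h1 h2
  rw [h1, h2]

theorem weightLE_wt {v w : Word} {c : ℤ} (hv : HasCharge v.letter c) (hw : HasCharge w.letter c)
    (h : ∀ k, v.letter k ≤ w.letter k) : WeightLE w.wt v.wt := by
  obtain ⟨N, hN⟩ := exists_letter_eq hv hw
  rw [WeightLE, wt_sub_wt hN]
  exact AddSubmonoid.sum_mem _ fun k _ => single_sub_mem_closure (h k)

theorem eq_of_height_le {v w : Word} {c : ℤ} (hv : HasCharge v.letter c)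
    (hw : HasCharge w.letter c) (h : ∀ k, v.letter k ≤ w.letter k)
    (hh : height v.wt ≤ height w.wt) : v = w := by
  obtain ⟨N, hN⟩ := exists_letter_eq hv hw
  have hsum : ∑ k ∈ Finset.range N, (w.letter k - v.letter k) = 0 := by
    refine le_antisymm ?_ (Finset.sum_nonneg fun k _ => sub_nonneg.2 (h k))
    rw [← sub_nonpos, ← map_sub, wt_sub_wt hN, map_sum] at hh
    simpa only [height_single_sub] using hh
  rw [Finset.sum_eq_zero_iff_of_nonneg fun k _ => sub_nonneg.2 (h k)] at hsum
  refine Word.ext (funext fun k => ?_)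
  rcases lt_or_ge k N with hk | hk
  · have := hsum k (Finset.mem_range.2 hk)
    omega
  · exact hN k hk

/-- Read from the trivial left end towards the right, barred letters increase strictly, so they stay
above the trivial sequence; once a letter is unbarred, `0` is the only bound. -/
theorem le_letter {w : Word} {c : ℤ} (hw : HasCharge w.letter c) (k : ℕ) :
    min 0 (-((k : ℤ) + 1 + c)) ≤ w.letter k := by
  obtain ⟨N, hN⟩ := Filter.eventually_atTop.1 hw
  have key : ∀ n k : ℕ, N ≤ k + n → min 0 (-((k : ℤ) + 1 + c)) ≤ w.letter k := by
    intro n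
    induction n with
    | zero =>
      intro k hk
      rw [hN k hk, bar]
      omega
    | succ n ih =>
      intro k hk
      have h1 := ih (k + 1) (by omega)
      have h2 := w.mono k
      have h3 := w.letter_lt (Nat.lt_add_one k)
      push_cast at h1
      omega
  exact key N k (by omega)

/-- The word `⋯ \overline{K+2} \overline{K+1} b ⋯ b` of charge `c`; it has no letter `b` if
`K ≤ c`. -/
def fill (K c b : ℤ) (hK : 0 ≤ K) (hb : 0 ≤ b) : Word where
  letter k := if (k : ℤ) + c < K then b else bar ((k : ℤ) + 1 + c)
  mono k := by
    simp only [bar]; push_cast; split_ifs <;> omega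
  degree_of_eq k := by
    simp only [bar, degree]; push_cast; split_ifs <;> omega
  charge := by
    refine ⟨c, ?_⟩
    filter_upwards [Filter.eventually_ge_atTop (K - c).toNat] with k hk
    rw [if_neg (by omega)]

theorem hasCharge_fill (K c b : ℤ) (hK : 0 ≤ K) (hb : 0 ≤ b) :
    HasCharge (fill K c b hK hb).letter c := by
  filter_upwards [Filter.eventually_ge_atTop (K - c).toNat] with k hk
  exact if_neg (by omega)

theorem fill_letter (K c b : ℤ) (hK : 0 ≤ K) (hb : 0 ≤ b) (k : ℕ) :
    (fill K c b hK hb).letter k = if (k : ℤ) + c < K then b else -((k : ℤ) + 1 + c) := rfl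

end Word

/-! ### Least tableaux and the highest weight element -/

open Word CrystalData

/-- The least tableau among those with letters `\overline{r + 1}` in the rows `r ≥ K` and unbarred
letters in the rows `r < K`. -/
def least (K : ℤ) (hK : 0 ≤ K) {u : ℕ} (lam : Fin u → ℤ) : Fin u → Word :=
  fun j => fill K (lam j) ((u : ℤ) - 1 - j) hK (by omega)

theorem highest_eq_least {u : ℕ} (lam : Fin u → ℤ) : highest lam = least 0 le_rfl lam := by
  refine funext fun j => Word.ext (funext fun k => ?_)
  have := j.2
  simp only [highest, hwWord, least, fill, unbar]
  rw [Nat.cast_sub j.2.le]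
  split_ifs <;> omega

theorem least_mem_tableaux {K : ℤ} (hK : 0 ≤ K) {u : ℕ} {lam : Fin u → ℤ} (hlam : Antitone lam) :
    least K hK lam ∈ tableaux lam := by
  rw [mem_tableaux]
  refine ⟨fun i => hasCharge_fill _ _ _ _ _, fun i j hij => ?_⟩
  have hle := hlam (show i ≤ j by rw [Fin.le_def]; omega)
  rw [adjacent_iff]
  intro k
  simp only [least, fill_letter]
  push_cast
  split_ifs <;> omega

theorem least_le {K : ℤ} (hK : 0 ≤ K) {u : ℕ} {lam : Fin u → ℤ} (hlam : Antitone lam)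
    {w : Fin u → Word} (hw : w ∈ tableaux lam)
    (h : ∀ j (k : ℕ), (k : ℤ) + lam j < K → 0 ≤ (w j).letter k) (j : Fin u) (k : ℕ) :
    (least K hK lam j).letter k ≤ (w j).letter k := by
  rw [mem_tableaux] at hw
  -- Induction from the last column leftwards: unbarred letters increase strictly along a row from
  -- right to left, so column `j` is at least the number `u - 1 - j` of columns to its right.
  have key : ∀ (n : ℕ) (j : Fin u), u ≤ j + 1 + n → ∀ k : ℕ, (k : ℤ) + lam j < K →
      (u : ℤ) - 1 - j ≤ (w j).letter k := by
    intro n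
    induction n with
    | zero =>
      intro j hj k hk
      have := h j k hk
      omega
    | succ n ih =>
      intro j hj k hk
      rcases Nat.lt_or_ge (j + 1) u with hj' | hj'
      · have h1 := hw.2 j ⟨j + 1, hj'⟩ rfl
        have hle := hlam (show j ≤ ⟨j + 1, hj'⟩ by rw [Fin.le_def]; simp)
        have h2 := ih ⟨j + 1, hj'⟩ (by simp only; omega)
          (k + (lam j - lam ⟨j + 1, hj'⟩).toNat) (by push_cast; omega)
        have h3 := h1.lt_or k
        have h4 := h j k hk
        push_cast at h2
        omega
      · have := h j k hk
        omega
  simp only [least, fill_letter]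
  split_ifs with hk
  · exact key u j (by omega) k hk
  · have := le_letter (hw.1 j) k
    omega

theorem highest_le {u : ℕ} {lam : Fin u → ℤ} (hlam : Antitone lam)
    {w : Fin u → Word} (hw : w ∈ tableaux lam) (j : Fin u) (k : ℕ) :
    (highest lam j).letter k ≤ (w j).letter k := by
  rw [highest_eq_least]
  refine least_le le_rfl hlam hw (fun j k hk => ?_) j k
  have := le_letter (hw.1 j) k
  omega

theorem highest_mem_tableaux {u : ℕ} {lam : Fin u → ℤ} (hlam : Antitone lam) :
    highest lam ∈ tableaux lam := by
  rw [highest_eq_least]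
  exact least_mem_tableaux le_rfl hlam

theorem tensorPow_crystal_wt {u : ℕ} (w : Fin u → Word) :
    (crystal.tensorPow u).wt w = ∑ j, (w j).wt := tensorPow_wt _ _

theorem weightLE_tensorPow_wt {u : ℕ} {lam : Fin u → ℤ} {v w : Fin u → Word}
    (hv : v ∈ tableaux lam) (hw : w ∈ tableaux lam)
    (h : ∀ j k, (v j).letter k ≤ (w j).letter k) :
    WeightLE ((crystal.tensorPow u).wt w) ((crystal.tensorPow u).wt v) := by
  rw [tensorPow_crystal_wt, tensorPow_crystal_wt, WeightLE, ← Finset.sum_sub_distrib]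
  exact AddSubmonoid.sum_mem _ fun j _ => weightLE_wt (hv.1 j) (hw.1 j) (h j)

theorem eq_of_height_tensorPow_le {u : ℕ} {lam : Fin u → ℤ} {v w : Fin u → Word}
    (hv : v ∈ tableaux lam) (hw : w ∈ tableaux lam)
    (h : ∀ j k, (v j).letter k ≤ (w j).letter k)
    (hh : height ((crystal.tensorPow u).wt v) ≤ height ((crystal.tensorPow u).wt w)) : v = w := by
  rw [tensorPow_crystal_wt, tensorPow_crystal_wt, map_sum, map_sum] at hh
  have hle : ∀ j ∈ Finset.univ, height (w j).wt ≤ height (v j).wt := fun j _ =>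
    (weightLE_wt (hv.1 j) (hw.1 j) (h j)).height_le
  have heq := (Finset.sum_eq_sum_iff_of_le hle).1 (le_antisymm (Finset.sum_le_sum hle) hh)
  exact funext fun j => eq_of_height_le (hv.1 j) (hw.1 j) (h j) (heq j (Finset.mem_univ j)).ge

theorem isHighestWeight_iff {u : ℕ} {lam : Fin u → ℤ} (hlam : Antitone lam) (w : Fin u → Word) :
    (crystal.tensorPow u).IsHighestWeight (tableaux lam) w ↔ w = highest lam := by
  have hmem := highest_mem_tableaux hlam
  constructor
  · rintro ⟨hw, h⟩
    exact (eq_of_height_tensorPow_le hmem hw (highest_le hlam hw) (h _ hmem).height_le).symm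
  · rintro rfl
    exact ⟨hmem, fun w hw => weightLE_tensorPow_wt hmem hw (highest_le hlam hw)⟩

/-! ### Connectedness -/

open Word CrystalData

/-- The number of occurrences of the letter `b` in a tuple of words. -/
noncomputable def totalCount {u : ℕ} (w : Fin u → Word) (b : ℤ) : ℕ := ∑ j, (w j).count b

theorem totalCount_pos {u : ℕ} {w : Fin u → Word} {b : ℤ} :
    0 < totalCount w b ↔ ∃ j k, (w j).letter k = b := by
  simp only [totalCount, Finset.sum_pos_iff, Finset.mem_univ, true_and, count_pos]

theorem tensorPow_wt_fst {u : ℕ} (w : Fin u → Word) : ((crystal.tensorPow u).wt w).1 = u := by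
  simp [tensorPow_crystal_wt, Prod.fst_sum, wt_fst]

theorem tensorPow_wt_snd {u : ℕ} (w : Fin u → Word) (b : ℤ) :
    ((crystal.tensorPow u).wt w).2 b = totalCount w b - if b < 0 then (u : ℤ) else 0 := by
  rw [tensorPow_crystal_wt, Prod.snd_sum, Finsupp.finsetSum_apply]
  simp only [wt_snd, Finset.sum_sub_distrib, totalCount, Nat.cast_sum]
  split_ifs <;> simp

theorem coroot_tensorPow_wt {u : ℕ} (w : Fin u → Word) {i : ℤ} (hi : i ≠ 0) :
    coroot i ((crystal.tensorPow u).wt w) = totalCount w (i - 1) - totalCount w i := by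
  rw [coroot_of_ne hi, tensorPow_wt_snd, tensorPow_wt_snd]
  split_ifs <;> omega

theorem coroot_zero_tensorPow_wt {u : ℕ} (w : Fin u → Word) :
    coroot 0 ((crystal.tensorPow u).wt w) = totalCount w (-1) + totalCount w 0 := by
  rw [coroot_zero, tensorPow_wt_fst, tensorPow_wt_snd, tensorPow_wt_snd]
  simp

theorem isNormal_tensorPow (u : ℕ) : (crystal.tensorPow u).IsNormal :=
  isNormal_crystal.tensorPow u

theorem totalCount_of_e {u : ℕ} {i : ℤ} {w w' : Fin u → Word}
    (h : (crystal.tensorPow u).e i w = some w') (b : ℤ) :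
    (totalCount w' b : ℤ) =
      totalCount w b + ((if b = i - 1 then 1 else 0) - (if b = i then 1 else 0)) := by
  have h1 := ((isNormal_tensorPow u).e_apply i w trivial w' h).2.2
  have h2 := congrArg (fun μ : Weight => μ.2 b) h1
  simp only [Prod.snd_add, Finsupp.add_apply, tensorPow_wt_snd, simpleRoot, root_apply] at h2
  omega

theorem e_of_f {u : ℕ} {i : ℤ} {w w' : Fin u → Word}
    (h : (crystal.tensorPow u).f i w = some w') : (crystal.tensorPow u).e i w' = some w :=
  ((isNormal_tensorPow u).f_iff_e i w trivial w' trivial).1 h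

theorem f_of_e {u : ℕ} {i : ℤ} {w w' : Fin u → Word}
    (h : (crystal.tensorPow u).e i w = some w') : (crystal.tensorPow u).f i w' = some w :=
  ((isNormal_tensorPow u).f_iff_e i w' trivial w trivial).2 h

/-- The tableaux with letters `\overline{r + 1}` in the rows `r ≥ K`. -/
def trivialFrom {u : ℕ} (K : ℤ) (lam : Fin u → ℤ) : Set (Fin u → Word) :=
  {w | w ∈ tableaux lam ∧
    ∀ j (k : ℕ), K ≤ (k : ℤ) + lam j → (w j).letter k = -((k : ℤ) + 1 + lam j)}

variable {u : ℕ} {K : ℤ} {lam : Fin u → ℤ}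

theorem trivialFrom_mono {L : ℤ} (h : K ≤ L) : trivialFrom K lam ⊆ trivialFrom L lam :=
  fun _ hw => ⟨hw.1, fun j k hk => hw.2 j k (h.trans hk)⟩

theorem exists_mem_trivialFrom {w : Fin u → Word} (hw : w ∈ tableaux lam) :
    ∃ K, w ∈ trivialFrom K lam := by
  have h : ∀ᶠ k : ℕ in Filter.atTop, ∀ j, (w j).letter k = bar ((k : ℤ) + 1 + lam j) :=
    Filter.eventually_all.2 hw.1
  obtain ⟨N, hN⟩ := Filter.eventually_atTop.1 h
  have hb : ∀ j, lam j ≤ ∑ i, |lam i| := fun j =>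
    (le_abs_self _).trans
      (Finset.single_le_sum (f := fun i => |lam i|) (fun i _ => abs_nonneg _) (Finset.mem_univ j))
  refine ⟨N + ∑ i, |lam i|, hw, fun j k hk => hN k ?_ j⟩
  have := hb j
  omega

/-- A colour `i > -K` changes only a letter that is at least `-K`, while the letters in rows from
`K` on are at most `-K - 1`. -/
theorem mem_trivialFrom_of_actsAt {i : ℤ} (hi : -K < i) {w w' : Fin u → Word}
    (hw : w ∈ trivialFrom K lam) (hw' : w' ∈ tableaux lam) {j : Fin u}
    (hne : ∀ k, k ≠ j → w' k = w k) (h : Lowers i (w j) (w' j) ∨ Lowers i (w' j) (w j)) :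
    w' ∈ trivialFrom K lam := by
  refine ⟨hw', fun l k hk => ?_⟩
  have hlk := hw.2 l k hk
  rcases eq_or_ne l j with rfl | hl
  · have key : ∃ p a, (w l).letter p ≥ -K ∧
        (w' l).letter = Function.update (w l).letter p a := by
      rcases h with ⟨p, hp, h⟩ | ⟨p, hp, h⟩
      · exact ⟨p, i - 1, by omega, h⟩
      · have := Lowers.eq_update hp h
        exact ⟨p, i, by omega, this.2⟩
    obtain ⟨p, a, hp, h⟩ := key
    rw [h, Function.update_of_ne, hlk]
    rintro rfl
    omega
  · rw [hne l hl, hlk]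

theorem e_mem_trivialFrom {i : ℤ} (hi : -K < i) {w w' : Fin u → Word}
    (hw : w ∈ trivialFrom K lam) (h : (crystal.tensorPow u).e i w = some w') :
    w' ∈ trivialFrom K lam := by
  obtain ⟨j, hj, -⟩ := exists_actsAt_of_e isNormal_crystal h
  exact mem_trivialFrom_of_actsAt hi hw ((isStable_tableaux lam i w hw.1).1 w' h) hj.eq_of_ne
    (Or.inl (eOp_eq_some_iff.1 hj.map_eq))

theorem f_mem_trivialFrom {i : ℤ} (hi : -K < i) {w w' : Fin u → Word}
    (hw : w ∈ trivialFrom K lam) (h : (crystal.tensorPow u).f i w = some w') :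
    w' ∈ trivialFrom K lam := by
  obtain ⟨j, hj, -⟩ := exists_actsAt_of_f isNormal_crystal h
  exact mem_trivialFrom_of_actsAt hi hw ((isStable_tableaux lam i w hw.1).2 w' h) hj.eq_of_ne
    (Or.inr (fOp_eq_some_iff.1 hj.map_eq))

/-- Two tableaux are linked if they lie in the same connected component. -/
def Linked (lam : Fin u → ℤ) : (Fin u → Word) → (Fin u → Word) → Prop :=
  Relation.EqvGen fun x y => x ∈ tableaux lam ∧ y ∈ tableaux lam ∧
    ∃ i, (crystal.tensorPow u).f i x = some y

theorem Linked.symm {w w' : Fin u → Word} (h : Linked lam w w') : Linked lam w' w :=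
  Relation.EqvGen.symm _ _ h

theorem Linked.trans {w w' w'' : Fin u → Word} (h : Linked lam w w') (h' : Linked lam w' w'') :
    Linked lam w w'' :=
  Relation.EqvGen.trans _ _ _ h h'

theorem linked_of_f {i : ℤ} {w w' : Fin u → Word} (hw : w ∈ tableaux lam)
    (h : (crystal.tensorPow u).f i w = some w') : Linked lam w w' :=
  Relation.EqvGen.rel _ _ ⟨hw, (isStable_tableaux lam i w hw).2 w' h, i, h⟩

theorem linked_of_e {i : ℤ} {w w' : Fin u → Word} (hw : w ∈ tableaux lam)
    (h : (crystal.tensorPow u).e i w = some w') : Linked lam w w' :=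
  (linked_of_f ((isStable_tableaux lam i w hw).1 w' h) (f_of_e h)).symm

/-- The equivalence of memberships is carried along so that, in the transitive case, the middle
tuple is known to be a tableau. -/
theorem Linked.eqvGen {w w' : Fin u → Word} (h : Linked lam w w') :
    (w ∈ tableaux lam ↔ w' ∈ tableaux lam) ∧ ∀ (hw : w ∈ tableaux lam) (hw' : w' ∈ tableaux lam),
      Relation.EqvGen (fun x y : tableaux lam =>
        ∃ i, (crystal.tensorPow u).f i x = some (y : Fin u → Word)) ⟨w, hw⟩ ⟨w', hw'⟩ := by
  induction h with
  | rel x y h => exact ⟨by simp [h.1, h.2.1], fun _ _ => Relation.EqvGen.rel _ _ h.2.2⟩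
  | refl x => exact ⟨Iff.rfl, fun _ _ => Relation.EqvGen.refl _⟩
  | symm x y _ ih => exact ⟨ih.1.symm, fun hx hy => Relation.EqvGen.symm _ _ (ih.2 hy hx)⟩
  | trans x y z _ _ ih1 ih2 =>
    exact ⟨ih1.1.trans ih2.1, fun hx hz =>
      Relation.EqvGen.trans _ _ _ (ih1.2 hx (ih1.1.1 hx)) (ih2.2 (ih1.1.1 hx) hz)⟩

/-- Apply `f_i` repeatedly, `n ≤ φ_i` times. -/
theorem exists_linked_of_le_phi {i : ℤ} (hi : -K < i) (n : ℕ) {w : Fin u → Word}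
    (hw : w ∈ trivialFrom K lam) (hn : n ≤ (crystal.tensorPow u).phi i w) :
    ∃ w' ∈ trivialFrom K lam, Linked lam w w' ∧ ∀ b, (totalCount w' b : ℤ) =
      totalCount w b + n * ((if b = i then 1 else 0) - (if b = i - 1 then 1 else 0)) := by
  induction n generalizing w with
  | zero => exact ⟨w, hw, Relation.EqvGen.refl _, fun b => by simp⟩
  | succ n ih =>
    obtain ⟨w₁, h₁⟩ := Option.ne_none_iff_exists'.1
      ((isNormal_tensorPow u).f_ne_none i w (by omega))
    have hphi := ((isNormal_tensorPow u).f_apply i w trivial w₁ h₁).2.1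
    obtain ⟨w', hw', hl, ht⟩ := ih (f_mem_trivialFrom hi hw h₁) (by omega)
    refine ⟨w', hw', (linked_of_f hw.1 h₁).trans hl, fun b => ?_⟩
    have := totalCount_of_e (e_of_f h₁) b
    rw [ht b, this]
    push_cast
    ring

/-- Shifting unbarred letters upwards, every occurrence of the smallest one can be removed. -/
theorem exists_linked_totalCount_zero (hK : 0 ≤ K) (n : ℕ) {w : Fin u → Word}
    (hw : w ∈ trivialFrom K lam) (hn : totalCount w n = 0) :
    ∃ w' ∈ trivialFrom K lam, Linked lam w w' ∧ totalCount w' 0 = 0 ∧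
      ∀ b < 0, totalCount w' b = totalCount w b := by
  induction n generalizing w with
  | zero => exact ⟨w, hw, Relation.EqvGen.refl _, hn, fun _ _ => rfl⟩
  | succ n ih =>
    have hi : ((n + 1 : ℕ) : ℤ) ≠ 0 := by omega
    -- As the letter `n + 1` is absent, `φ_{n+1} - ε_{n+1}` is the number of letters `n`; hence
    -- `f_{n+1}` can be applied often enough to remove them all.
    have h1 := (isNormal_tensorPow u).string _ hi w trivial
    rw [coroot_tensorPow_wt w hi, hn] at h1
    push_cast at h1
    rw [add_sub_cancel_right] at h1
    obtain ⟨w₁, hw₁, hl₁, ht₁⟩ := exists_linked_of_le_phi (i := (n : ℤ) + 1) (by omega)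
      (totalCount w n) hw (by omega)
    obtain ⟨w', hw', hl, h0, ht⟩ := ih hw₁ (by
      have := ht₁ n
      simp at this
      exact this)
    refine ⟨w', hw', hl₁.trans hl, h0, fun b hb => ?_⟩
    have := ht₁ b
    rw [if_neg (by omega), if_neg (by omega)] at this
    rw [ht b hb]
    omega

theorem exists_totalCount_eq_zero (w : Fin u → Word) : ∃ n : ℕ, totalCount w n = 0 := by
  refine ⟨∑ j, ((w j).letter 0).toNat + 1, ?_⟩
  by_contra h
  obtain ⟨j, k, hjk⟩ := totalCount_pos.1 (Nat.pos_of_ne_zero h)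
  have h1 := (w j).antitone (Nat.zero_le k)
  have h2 := Finset.single_le_sum (f := fun j => ((w j).letter 0).toNat)
    (fun _ _ => Nat.zero_le _) (Finset.mem_univ j)
  omega

/-- The number of letters between `\overline K` and `\overline 1`. -/
noncomputable def barredCount (K : ℤ) (w : Fin u → Word) : ℕ :=
  ∑ b ∈ Finset.Ico (-K) 0, totalCount w b

theorem barredCount_of_e {i : ℤ} {w w' : Fin u → Word}
    (h : (crystal.tensorPow u).e i w = some w') :
    (barredCount K w' : ℤ) = barredCount K w +
      ((if -K ≤ i - 1 ∧ i - 1 < 0 then 1 else 0) - (if -K ≤ i ∧ i < 0 then 1 else 0)) := by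
  simp only [barredCount, Nat.cast_sum, totalCount_of_e h, Finset.sum_add_distrib,
    Finset.sum_sub_distrib, Finset.sum_ite_eq', Finset.mem_Ico]

/-- Raising barred letters, the letter `\overline 1` can be produced. -/
theorem exists_linked_totalCount_neg_one (n : ℕ) (hn : (n : ℤ) + 1 ≤ K) {w : Fin u → Word}
    (hw : w ∈ trivialFrom K lam) (hpos : 0 < totalCount w (-1 - n)) :
    ∃ w' ∈ trivialFrom K lam, Linked lam w w' ∧ 0 < totalCount w' (-1) ∧
      totalCount w' 0 = totalCount w 0 ∧ barredCount K w' = barredCount K w := by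
  induction n generalizing w with
  | zero => exact ⟨w, hw, Relation.EqvGen.refl _, by simpa using hpos, rfl, rfl⟩
  | succ n ih =>
    push_cast at hn hpos
    rcases Nat.eq_zero_or_pos (totalCount w (-1 - n)) with h0 | h0
    -- The letter `-1 - n` is absent and the one below it is present, so `φ` is positive for this
    -- colour and `f` creates the missing letter.
    · have hi : (-1 - n : ℤ) ≠ 0 := by omega
      have h1 := (isNormal_tensorPow u).string _ hi w trivial
      rw [coroot_tensorPow_wt w hi, h0, show (-1 - n : ℤ) - 1 = -1 - (n + 1) by ring] at h1
      obtain ⟨w₁, h₁⟩ := Option.ne_none_iff_exists'.1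
        ((isNormal_tensorPow u).f_ne_none (-1 - n) w (by omega))
      have hcount := totalCount_of_e (e_of_f h₁)
      have hb := barredCount_of_e (K := K) (e_of_f h₁)
      rw [if_pos (by omega), if_pos (by omega)] at hb
      obtain ⟨w', hw', hl, h2, h3, h4⟩ := ih (by omega)
        (f_mem_trivialFrom (by omega) hw h₁) (by
          have := hcount (-1 - n)
          rw [if_neg (by omega), if_pos rfl] at this
          omega)
      refine ⟨w', hw', (linked_of_f hw.1 h₁).trans hl, h2, ?_, by omega⟩
      have := hcount 0
      rw [if_neg (by omega), if_neg (by omega)] at this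
      omega
    · exact ih (by omega) hw h0

/-- Without a letter `0`, `e_0` has nothing to lower, so `ε_0 = 0`. A letter `-1` makes `⟨h_0, wt⟩`
positive, so `φ_0 = 1`, and `f_0` turns a barred letter into an unbarred one. -/
theorem exists_linked_f_zero (hK : 0 < K) {w : Fin u → Word} (hw : w ∈ trivialFrom K lam)
    (h0 : totalCount w 0 = 0) (h1 : 0 < totalCount w (-1)) :
    ∃ w' ∈ trivialFrom K lam, Linked lam w w' ∧ barredCount K w' < barredCount K w := by
  have heps : (crystal.tensorPow u).eps 0 w = 0 := by
    by_contra hne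
    obtain ⟨w₁, h₁⟩ := Option.ne_none_iff_exists'.1
      ((isNormal_tensorPow u).e_ne_none 0 w (Nat.pos_of_ne_zero hne))
    have := totalCount_of_e h₁ 0
    rw [if_neg (by omega), if_pos rfl] at this
    omega
  have hphi := (isNormal_tensorPow u).odd_pos w trivial (by
    rw [coroot_zero_tensorPow_wt]
    omega)
  obtain ⟨w₁, h₁⟩ := Option.ne_none_iff_exists'.1
    ((isNormal_tensorPow u).f_ne_none 0 w (by omega))
  have hb := barredCount_of_e (K := K) (e_of_f h₁)
  rw [if_pos (by omega), if_neg (by omega)] at hb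
  exact ⟨w₁, f_mem_trivialFrom (by omega) hw h₁, linked_of_f hw.1 h₁, by omega⟩

theorem letter_nonneg_of_barredCount {w : Fin u → Word} (hw : w ∈ tableaux lam)
    (h : barredCount K w = 0) (j : Fin u) (k : ℕ) (hk : (k : ℤ) + lam j < K) :
    0 ≤ (w j).letter k := by
  by_contra hlt
  have h1 := le_letter (hw.1 j) k
  have h2 : 0 < totalCount w ((w j).letter k) := totalCount_pos.2 ⟨j, k, rfl⟩
  have h3 := (Finset.sum_eq_zero_iff.1 h) ((w j).letter k) (Finset.mem_Ico.2 (by omega))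
  omega

/-- A tableau without barred letters in the rows above `K`, other than the least one, admits an
operator `e_i` with `i > 0`. -/
theorem exists_e_of_ne_least (hK : 0 ≤ K) (hlam : Antitone lam) {w : Fin u → Word}
    (hw : w ∈ trivialFrom K lam) (h : barredCount K w = 0) (hne : w ≠ least K hK lam) :
    ∃ i > 0, ∃ w', (crystal.tensorPow u).e i w = some w' := by
  obtain ⟨j₀, hj₀⟩ := Function.ne_iff.1 hne
  -- In the last column `j` that differs from `least`, some letter `b` exceeds `u - 1 - j`. The
  -- unbarred letters further right are at most `u - 2 - j`, so `b - 1` does not occur there and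
  -- `tensorPow_eps_pos` applies to colour `b`.
  obtain ⟨j, hj, hmax⟩ := Set.exists_max_image {j | w j ≠ least K hK lam j} id (Set.toFinite _)
    ⟨j₀, hj₀⟩
  simp only [Set.mem_ofPred_eq, id] at hj hmax
  have hk : ∃ k, (w j).letter k ≠ (least K hK lam j).letter k := by
    by_contra hcon
    push Not at hcon
    exact hj (Word.ext (funext hcon))
  obtain ⟨k, hk⟩ := hk
  have hle := least_le hK hlam hw.1 (letter_nonneg_of_barredCount hw.1 h) j k
  have hlt : (u : ℤ) - 1 - j < (w j).letter k := by
    simp only [least, fill_letter] at hk hle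
    split_ifs at hk hle with hkK
    · omega
    · exact absurd (hw.2 j k (not_lt.1 hkK)) hk
  have hpos : 0 < (w j).letter k := by omega
  refine ⟨(w j).letter k, hpos, Option.ne_none_iff_exists'.1 ?_⟩
  refine (isNormal_tensorPow u).e_ne_none _ _ (tensorPow_eps_pos isNormal_crystal hpos w j ?_ ?_)
  · rw [crystal_eps, epsCount, if_neg hpos.not_ge]
    exact count_pos.2 ⟨k, rfl⟩
  · intro l hl
    change coroot _ (w l).wt ≤ 0
    rw [coroot_wt hpos.ne']
    have : (w l).count ((w j).letter k - 1) = 0 := by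
      rw [count_eq_zero]
      intro m
      have hwl : w l = least K hK lam l := by
        by_contra hcon
        exact (hmax l hcon).not_gt hl
      rw [hwl]
      simp only [least, fill_letter]
      rw [Fin.lt_def] at hl
      split_ifs <;> omega
    omega

/-- Each `e_i` raises the height by one, while `least` bounds it from above; `n` bounds the
remaining gap, and gap zero forces equality. -/
theorem linked_least_of_barredCount_eq_zero (hK : 0 ≤ K) (hlam : Antitone lam) (n : ℕ)
    {w : Fin u → Word} (hw : w ∈ trivialFrom K lam) (h : barredCount K w = 0)
    (hn : height ((crystal.tensorPow u).wt (least K hK lam)) ≤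
      height ((crystal.tensorPow u).wt w) + n) : Linked lam w (least K hK lam) := by
  have hmem := least_mem_tableaux hK hlam
  induction n generalizing w with
  | zero =>
    rw [eq_of_height_tensorPow_le hmem hw.1
      (least_le hK hlam hw.1 (letter_nonneg_of_barredCount hw.1 h)) (by simpa using hn)]
    exact Relation.EqvGen.refl _
  | succ n ih =>
    by_cases hne : w = least K hK lam
    · rw [hne]
      exact Relation.EqvGen.refl _
    obtain ⟨i, hi, w₁, h₁⟩ := exists_e_of_ne_least hK hlam hw h hne
    have hb := barredCount_of_e (K := K) h₁
    rw [if_neg (by omega), if_neg (by omega)] at hb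
    refine (linked_of_e hw.1 h₁).trans (ih (e_mem_trivialFrom (by omega) hw h₁) (by omega) ?_)
    rw [((isNormal_tensorPow u).e_apply i w trivial w₁ h₁).2.2, map_add, height_simpleRoot]
    push_cast at hn
    omega

/-- Induction on the number of barred letters: empty the letter `0`, bring a barred letter up to
`-1`, and apply `f_0`. -/
theorem linked_least (hK : 0 ≤ K) (hlam : Antitone lam) (n : ℕ) {w : Fin u → Word}
    (hw : w ∈ trivialFrom K lam) (hn : barredCount K w ≤ n) : Linked lam w (least K hK lam) := by
  induction n generalizing w with
  | zero =>
    exact linked_least_of_barredCount_eq_zero hK hlam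
      (height ((crystal.tensorPow u).wt (least K hK lam)) -
        height ((crystal.tensorPow u).wt w)).toNat hw (by omega) (by omega)
  | succ n ih =>
    rcases Nat.eq_zero_or_pos (barredCount K w) with h0 | h0
    · exact ih hw (by omega)
    obtain ⟨b, hb, hpos⟩ := Finset.sum_pos_iff.1 h0
    rw [Finset.mem_Ico] at hb
    obtain ⟨M, hM⟩ := exists_totalCount_eq_zero w
    obtain ⟨w₁, hw₁, hl₁, hz₁, hc₁⟩ := exists_linked_totalCount_zero hK M hw hM
    have hbar : barredCount K w₁ = barredCount K w :=
      Finset.sum_congr rfl fun b hb => hc₁ b (Finset.mem_Ico.1 hb).2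
    have hb' : b = -1 - ((-1 - b).toNat : ℤ) := by omega
    obtain ⟨w₂, hw₂, hl₂, hp₂, hz₂, hbar₂⟩ := exists_linked_totalCount_neg_one (-1 - b).toNat
      (by omega) hw₁ (by rw [← hb', hc₁ b hb.2]; exact hpos)
    obtain ⟨w₃, hw₃, hl₃, hlt⟩ := exists_linked_f_zero (by omega) hw₂ (by omega) hp₂
    exact hl₁.trans (hl₂.trans (hl₃.trans (ih hw₃ (by omega))))

theorem isConnectedOn_tableaux (hlam : Antitone lam) :
    (crystal.tensorPow u).IsConnectedOn (tableaux lam) := by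
  refine ⟨⟨_, highest_mem_tableaux hlam⟩, fun ⟨w, hw⟩ ⟨w', hw'⟩ => ?_⟩
  obtain ⟨K, hK⟩ := exists_mem_trivialFrom hw
  obtain ⟨L, hL⟩ := exists_mem_trivialFrom hw'
  -- A common bound on the nontrivial rows gives both tableaux the same target `least`.
  have h0 : 0 ≤ max 0 (max K L) := le_max_left _ _
  have h1 := linked_least h0 hlam _ (trivialFrom_mono (by omega) hK) le_rfl
  have h2 := linked_least h0 hlam _ (trivialFrom_mono (by omega) hL) le_rfl
  exact (h1.trans h2.symm).eqvGen.2 hw hw'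

end SemiInf

theorem proposition5p2 (u : ℕ) (hu : 1 ≤ u) (lam : Fin u → ℤ) (hlam : Antitone lam) :
    (SemiInf.Word.crystal.tensorPow u).IsStable (SemiInf.tableaux lam) ∧
    (SemiInf.Word.crystal.tensorPow u).IsCrystalOn (SemiInf.tableaux lam) ∧
    (SemiInf.Word.crystal.tensorPow u).IsConnectedOn (SemiInf.tableaux lam) ∧
    ∀ w : Fin u → SemiInf.Word,
      (SemiInf.Word.crystal.tensorPow u).IsHighestWeight (SemiInf.tableaux lam) w ↔
        w = SemiInf.highest lam :=
  have h := SemiInf.isStable_tableaux lam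
  ⟨h, (SemiInf.isNormal_tensorPow u).toIsCrystalOn.restrict h, SemiInf.isConnectedOn_tableaux hlam,
    SemiInf.isHighestWeight_iff hlam⟩
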